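/- **Setting.** Let $\mathcal T=\{(j,k):0\le j\le J,\ 0\le k<2^j\}$ be the binary tree in which $(j,k)$ with $j\ge1$ has parent $(j-1,\lfloor k/2\rfloor)$ and $(j,k)$ with $j<J$ has children $(j+1,2k)$, $(j+1,2k+1)$. There are $G\ge1$ groups with $n_g$ observations in group $g$, and $n=\sum_g n_g$. The hyperparameters are $\nu,\sigma_0^2,\alpha,\tau,\upsilon>0$, with $\tau_j=2^{-\alpha j}\tau$ and $\upsilon_j=2^{-\alpha j}\upsilon$; probability vectors $\rho_{0,0},\kappa_{0,0}$ on $\{0,1\}$; and stochastic matrices $\rho_{j,k},\kappa_{j,k}$ on $\{0,1\}$ for $1\le j\le J$. A *Markov tree* on a finite state space, with given initial and transition probabilities, is a random configuration $x=(x_{j,k})_{(j,k)\in\mathcal T}$ whose probability is the initial probability of $x_{0,0}$ times the product over the nodes with $j\ge1$ of the transition probability from $x_{j-1,\lfloor k/2\rfloor}$ to $x_{j,k}$. **Model (one-way NIG-MG).** $(S_{j,k})$ and $(R_{j,k})$ are independent Markov trees on $\{0,1\}$ with initial and transition probabilities given by $\rho$ and by $\kappa$. Given all $(S,R)$, the parameters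 of different nodes are independent, $\sigma_{j,k}^2\sim\text{Inv-Gamma}(\nu+1,\nu\sigma_0^2)$ (shape, rate), and given $\sigma^2_{j,k}$ the variables $z_{j,k}\sim N(0,S_{j,k}\tau_j\sigma_{j,k}^2)$ and $\beta^{(g)}_{j,k}\sim N(0,R_{j,k}\upsilon_j\sigma_{j,k}^2)$, $2\le g\le G$, are independent; $\beta^{(1)}_{j,k}=0$. Given all of these, the data $\mathcal D$ consist of independent $d^{(g,i)}_{j,k}\sim N(z_{j,k}+\beta^{(g)}_{j,k},\sigma^2_{j,k})$, $1\le g\le G$, $1\le i\le n_g$. **Notation.** Let $d_{j,k}\in\mathbb R^n$ be the data vector of a node. For $s,r\in\{0,1\}$ let $X(s,r)=(s\mathbf 1_n,r e_2,\dots,r e_G)$, where $e_g$ is the indicator vector of the observations in group $g$, let $\Lambda_j=\mathrm{diag}(1/\tau_j,1/\upsilon_j,\dots,1/\upsilon_j)$ (of size $G$), and let $$M(s,r)=\begin{pmatrix}s&sr\mathbf 1_{G-1}'\\ sr\mathbf 1_{G-1}&r\mathbf 1_{G-1}\mathbf 1_{G-1}'\end{pmatrix},\qquad \Lambda_j^*(s,r)=X(s,r)'X(s,r)+\Lambda_j,$$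 $$\mu^*_{j,k}(s,r)=\Lambda_j^*(s,r)^{-1}X(s,r)'d_{j,k},\qquad \Upsilon_{j,k}(s,r)=\tfrac12\big\{d_{j,k}'d_{j,k}-\mu^*_{j,k}(s,r)'\Lambda^*_j(s,r)\mu^*_{j,k}(s,r)\big\},$$ $$m_{j,k}(s,r)=\frac{(\nu\sigma_0^2)^{\nu+1}\Gamma(\nu+n/2+1)}{(2\pi)^{n/2}\Gamma(\nu+1)}\cdot\frac{|\Lambda_j|^{1/2}}{|\Lambda_j^*(s,r)|^{1/2}}\cdot\big[\nu\sigma_0^2+\Upsilon_{j,k}(s,r)\big]^{-\nu-n/2-1}.$$ Define $\phi_{j,k},\xi_{j,k}$ on $\{0,1\}^2$ recursively in the order $j=J,J-1,\dots,0$ by $$\phi_{j,k}(s,r)=\begin{cases}m_{j,k}(s,r)\,\xi_{j+1,2k}(s,r)\,\xi_{j+1,2k+1}(s,r)&j<J\\ m_{j,k}(s,r)&j=J,\end{cases}$$ $$\xi_{j,k}(s,r)=\begin{cases}\sum_{s',r'}\rho_{j,k}(s,s')\kappa_{j,k}(r,r')\phi_{j,k}(s',r')&j\ge1\\ \sum_{s',r'}\rho_{0,0}(s')\kappa_{0,0}(r')\phi_{0,0}(s',r')&j=0.\end{cases}$$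 **Theorem.** Let the posterior given $\mathcal D$ be the probability measure on all latent quantities $(S,R,\sigma^2,z,\beta)$ whose density with respect to the prior is the likelihood divided by the marginal likelihood. It is a version of the conditional law of the latent quantities given the data. For every $\mathcal D$, $m_{j,k}(s,r)$ is the marginal likelihood of $d_{j,k}$ given $S_{j,k}=s,R_{j,k}=r$; $\phi_{j,k}\ge0$ and $\xi_{j,k}>0$; and the posterior is as follows. 1. The hidden states $\{(S_{j,k},R_{j,k})\}$ form a Markov tree on $\{0,1\}\times\{0,1\}$ with transition probabilities, for $j\ge1$, $$\Pr(S_{j,k}=s',R_{j,k}=r'\mid S_{j-1,\lfloor k/2\rfloor}=s,R_{j-1,\lfloor k/2\rfloor}=r,\mathcal D)=\rho_{j,k}(s,s')\kappa_{j,k}(r,r')\phi_{j,k}(s',r')/\xi_{j,k}(s,r)$$ (as conditional probabilities, whenever the conditioning event has positive posterior probability) and initial probabilities $$\Pr(S_{0,0}=s,R_{0,0}=r\mid\mathcal D)=\rho_{0,0}(s)\kappa_{0,0}(r)\phi_{0,0}(s,r)/\xi_{0,0}(0,0).$$ 2. $[\sigma^2_{j,k}\mid S_{j,k},R_{j,k},\mathcal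 D]\sim\text{Inv-Gamma}\big(\nu+1+\tfrac n2,\ \nu\sigma_0^2+\Upsilon_{j,k}(S_{j,k},R_{j,k})\big)$. 3. $[(z_{j,k},\beta^{(2)}_{j,k},\dots,\beta^{(G)}_{j,k})\mid\sigma^2_{j,k},S_{j,k},R_{j,k},\mathcal D]\sim N\big(\mu^*_{j,k}(S_{j,k},R_{j,k}),\ \sigma^2_{j,k}\,M(S_{j,k},R_{j,k})\circ\Lambda^*_j(S_{j,k},R_{j,k})^{-1}\big)$, where $\circ$ is the Hadamard product and the normal law may be degenerate. 4. Given all hidden states and $\mathcal D$, the parameters $(\sigma^2_{j,k},z_{j,k},\beta_{j,k})$ of the different nodes are independent, and the law of those of a node depends only on the hidden states of that node. -/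

import Mathlib

open MeasureTheory ProbabilityTheory
open scoped ENNReal NNReal Matrix

noncomputable section

/-! ### The location-scale tree -/

/-- Nodes `(j, k)` with `0 ≤ j ≤ J` and `0 ≤ k < 2 ^ j`. -/
abbrev Node (J : ℕ) : Type := Σ j : Fin (J + 1), Fin (2 ^ (j : ℕ))

namespace Node

variable {J : ℕ}

/-- The node `(0, 0)`. -/
def root : Node J := ⟨0, ⟨0, by positivity⟩⟩

/-- The parent `(j - 1, ⌊k / 2⌋)` of `(j, k)`; the root is sent to itself. -/
def parent (v : Node J) : Node J :=
  ⟨⟨(v.1 : ℕ) - 1, by have := v.1.2; omega⟩, ⟨(v.2 : ℕ) / 2, by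
    obtain ⟨⟨j, hj⟩, ⟨k, hk⟩⟩ := v
    cases j with
    | zero => simp at hk ⊢; omega
    | succ i => simp only [pow_succ, Nat.add_sub_cancel] at hk ⊢; omega⟩⟩

/-- The child `(j + 1, 2 k)`. -/
def left (v : Node J) (h : (v.1 : ℕ) < J) : Node J :=
  ⟨⟨(v.1 : ℕ) + 1, by omega⟩, ⟨2 * (v.2 : ℕ), by
    have := v.2.2
    simp only [pow_succ]; omega⟩⟩

/-- The child `(j + 1, 2 k + 1)`. -/
def right (v : Node J) (h : (v.1 : ℕ) < J) : Node J :=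
  ⟨⟨(v.1 : ℕ) + 1, by omega⟩, ⟨2 * (v.2 : ℕ) + 1, by
    have := v.2.2
    simp only [pow_succ]; omega⟩⟩

end Node

/-! ### Markov trees -/

/-- `init` is a probability vector and, for every node other than the root, `trans v` is a
stochastic matrix (`trans v a b` is the probability of state `b` at `v` when the parent of `v` is
in state `a`). The value of `trans` at the root is never used. -/
structure IsStochasticTree {J : ℕ} {S : Type} [Fintype S]
    (init : S → ℝ) (trans : Node J → S → S → ℝ) : Prop where
  init_nonneg : ∀ a, 0 ≤ init a
  init_sum : ∑ a, init a = 1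
  trans_nonneg : ∀ v, v ≠ Node.root → ∀ a b, 0 ≤ trans v a b
  trans_sum : ∀ v, v ≠ Node.root → ∀ a, ∑ b, trans v a b = 1

/-- The probability of a configuration under the Markov tree with initial probabilities `init` and
transition probabilities `trans`. -/
def treeProb {J : ℕ} {S : Type} (init : S → ℝ) (trans : Node J → S → S → ℝ)
    (x : Node J → S) : ℝ :=
  init (x Node.root) *
    ∏ v ∈ Finset.univ.filter (fun v : Node J => v ≠ Node.root), trans v (x v.parent) (x v)

/-- The law of the Markov tree with initial probabilities `init` and transition probabilities
`trans`. -/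
def markovTree {J : ℕ} {S : Type} [Fintype S] [DecidableEq S] [MeasurableSpace S]
    (init : S → ℝ) (trans : Node J → S → S → ℝ) : Measure (Node J → S) :=
  ∑ x : Node J → S, ENNReal.ofReal (treeProb init trans x) • Measure.dirac x

instance {J : ℕ} {S : Type} [Fintype S] [DecidableEq S] [MeasurableSpace S]
    (init : S → ℝ) (trans : Node J → S → S → ℝ) : IsFiniteMeasure (markovTree init trans) := by
  refine ⟨?_⟩
  simp only [markovTree, Measure.coe_finsetSum, Finset.sum_apply, Measure.smul_apply, smul_eq_mul]
  exact ENNReal.sum_lt_top.2 fun x _ => by simp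

/-! ### Distributions -/

/-- The inverse-Gamma distribution with shape `a` and rate `b`: the law of `1 / Y` where `Y` is
Gamma with shape `a` and rate `b`. -/
def invGammaMeasure (a b : ℝ) : Measure ℝ := (gammaMeasure a b).map (fun y => y⁻¹)

lemma isProbabilityMeasure_invGammaMeasure {a b : ℝ} (ha : 0 < a) (hb : 0 < b) :
    IsProbabilityMeasure (invGammaMeasure a b) := by
  have := isProbabilityMeasure_gammaMeasure ha hb
  exact Measure.isProbabilityMeasure_map measurable_inv.aemeasurable

/-- The (possibly degenerate) normal distribution with mean `m` and covariance matrix `C`, as a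
measure on `ι → ℝ`. -/
def normalVec {ι : Type} [Fintype ι] [DecidableEq ι] (m : ι → ℝ) (C : Matrix ι ι ℝ) :
    Measure (ι → ℝ) :=
  (multivariateGaussian (WithLp.toLp 2 m) C).map WithLp.ofLp

/-- A finite product of probability measures depends measurably on a parameter if its factors do. -/
lemma measurable_measure_pi {α ι : Type} [MeasurableSpace α] [Fintype ι] {E : ι → Type}
    [∀ i, MeasurableSpace (E i)] (κ : ∀ i, α → Measure (E i))
    [∀ i a, IsProbabilityMeasure (κ i a)] (hκ : ∀ i, Measurable (κ i)) :
    Measurable (fun a => Measure.pi (fun i => κ i a)) := by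
  refine Measurable.measure_of_isPiSystem_of_isProbabilityMeasure
    generateFrom_pi.symm isPiSystem_pi ?_
  rintro _ ⟨t, ht, rfl⟩
  simp only [Measure.pi_pi]
  exact Finset.measurable_prod _ fun i _ =>
    (Measure.measurable_coe (ht i (Set.mem_univ i))).comp (hκ i)

/-! ### The one-way model -/

/-- The hyperparameters of the one-way normal-inverse-Gamma Markov grove, for a tree of depth `J`,
`G = K + 1` groups (group `0` is the baseline) and `n g` replicates in group `g`. -/
structure NIGMG (J K : ℕ) (n : Fin (K + 1) → ℕ) where
  ν : ℝ
  /-- the prior variance scale `σ₀²` -/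
  σ₀sq : ℝ
  α : ℝ
  τ : ℝ
  υ : ℝ
  ρinit : Fin 2 → ℝ
  ρ : Node J → Fin 2 → Fin 2 → ℝ
  κinit : Fin 2 → ℝ
  κ : Node J → Fin 2 → Fin 2 → ℝ
  ν_pos : 0 < ν
  σ₀sq_pos : 0 < σ₀sq
  α_pos : 0 < α
  τ_pos : 0 < τ
  υ_pos : 0 < υ
  ρ_stochastic : IsStochasticTree ρinit ρ
  κ_stochastic : IsStochasticTree κinit κ

/-- Observations: pairs of a group `g` and a replicate `i` in that group. -/
abbrev Obs {K : ℕ} (n : Fin (K + 1) → ℕ) : Type := Σ g : Fin (K + 1), Fin (n g)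

/-- Hidden states `(s, r)` of a node. -/
abbrev HState : Type := Fin 2 × Fin 2

/-- Parameters `(σ², θ)` of a node, with `θ 0 = z` and `θ g = β^(g)` for `g ≠ 0`. -/
abbrev NodeParam (K : ℕ) : Type := ℝ × (Fin (K + 1) → ℝ)

/-- All latent quantities: the hidden states and the parameters of all nodes. -/
abbrev Latent (J K : ℕ) : Type := (Node J → HState) × (Node J → NodeParam K)

/-- The data: the empirical wavelet coefficients `d_{j,k}^{(g,i)}`. -/
abbrev Data (J : ℕ) {K : ℕ} (n : Fin (K + 1) → ℕ) : Type := Node J → Obs n → ℝ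

namespace Latent

variable {J K : ℕ}

/-- `(S_v, R_v)` -/
def state (v : Node J) (ω : Latent J K) : HState := ω.1 v

/-- `σ²_v` -/
def var (v : Node J) (ω : Latent J K) : ℝ := (ω.2 v).1

/-- `(z_v, β_v^{(2)}, …, β_v^{(G)})` -/
def coef (v : Node J) (ω : Latent J K) : Fin (K + 1) → ℝ := (ω.2 v).2

/-- `(σ²_v, z_v, β_v^{(2)}, …, β_v^{(G)})` -/
def param (v : Node J) (ω : Latent J K) : NodeParam K := ω.2 v

end Latent

/-- The mean `z + β^(g)` of an observation in group `g`, with `β^(0) = 0` for the baseline. -/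
def groupMean {K : ℕ} (θ : Fin (K + 1) → ℝ) (g : Fin (K + 1)) : ℝ :=
  θ 0 + if g = 0 then 0 else θ g

namespace NIGMG

variable {J K : ℕ} {n : Fin (K + 1) → ℕ} (P : NIGMG J K n)

/-- `τ_j = 2 ^ (-α j) τ` -/
def τj (j : ℕ) : ℝ := (2 : ℝ) ^ (-P.α * j) * P.τ

/-- `υ_j = 2 ^ (-α j) υ` -/
def υj (j : ℕ) : ℝ := (2 : ℝ) ^ (-P.α * j) * P.υ

/-! #### Prior -/

/-- The prior law of all hidden states: `S` and `R` are independent Markov trees. -/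
def statePrior : Measure (Node J → HState) :=
  ((markovTree P.ρinit P.ρ).prod (markovTree P.κinit P.κ)).map (fun p v => (p.1 v, p.2 v))

/-- Prior variance of the coefficient with index `c` at a node of level `j`, given the hidden
states `a = (s, r)` and `σ²`: `s τ_j σ²` for `z` and `r υ_j σ²` for each `β^(g)`. -/
def coefVar (j : ℕ) (a : HState) (c : Fin (K + 1)) (σsq : ℝ) : ℝ :=
  (if c = 0 then ((a.1 : ℕ) : ℝ) * P.τj j else ((a.2 : ℕ) : ℝ) * P.υj j) * σsq

/-- Prior law of `θ` at a node of level `j` given the hidden states and `σ²`: independent centred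
normal coordinates. -/
def coefPrior (j : ℕ) (a : HState) : Kernel ℝ (Fin (K + 1) → ℝ) where
  toFun σsq := Measure.pi fun c => gaussianReal 0 (P.coefVar j a c σsq).toNNReal
  measurable' := by
    refine measurable_measure_pi _ fun c => ?_
    have h : Measurable fun σsq : ℝ => ((0 : ℝ), (P.coefVar j a c σsq).toNNReal) := by
      unfold coefVar; fun_prop
    exact measurable_gaussianReal.comp h

instance (j : ℕ) (a : HState) : IsMarkovKernel (P.coefPrior j a) :=
  ⟨fun σsq => by
    change IsProbabilityMeasure (Measure.pi fun c => gaussianReal 0 (P.coefVar j a c σsq).toNNReal)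
    infer_instance⟩

/-- Prior law of `(σ², θ)` at the node `v` given its hidden states:
`σ² ~ Inv-Gamma(ν + 1, ν σ₀²)`, and `θ` given `σ²` as in `coefPrior`. -/
def nodePrior (v : Node J) (a : HState) : Measure (NodeParam K) :=
  invGammaMeasure (P.ν + 1) (P.ν * P.σ₀sq) ⊗ₘ P.coefPrior v.1 a

instance (v : Node J) (a : HState) : IsProbabilityMeasure (P.nodePrior v a) := by
  have := isProbabilityMeasure_invGammaMeasure (a := P.ν + 1) (b := P.ν * P.σ₀sq)
    (by linarith [P.ν_pos]) (mul_pos P.ν_pos P.σ₀sq_pos)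
  unfold nodePrior
  infer_instance

/-- Given all hidden states, the parameters of the nodes are independent. -/
def paramPrior : Kernel (Node J → HState) (Node J → NodeParam K) :=
  Kernel.ofFunOfCountable fun x => Measure.pi fun v => P.nodePrior v (x v)

instance : IsMarkovKernel P.paramPrior :=
  ⟨fun x => by
    change IsProbabilityMeasure (Measure.pi fun v => P.nodePrior v (x v))
    infer_instance⟩

/-- The prior on all latent quantities. -/
def prior : Measure (Latent J K) := P.statePrior ⊗ₘ P.paramPrior

instance : IsFiniteMeasure P.statePrior := by unfold statePrior; infer_instance

instance : IsFiniteMeasure P.prior := by unfold prior; infer_instance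

/-! #### Likelihood and posterior -/

/-- The sampling model: given the latent quantities, the observations
`d_v^{(g,i)} ~ N(z_v + β_v^{(g)}, σ²_v)` are independent. -/
def sampling (J : ℕ) {K : ℕ} (n : Fin (K + 1) → ℕ) : Kernel (Latent J K) (Data J n) where
  toFun ω := Measure.pi fun v => Measure.pi fun h : Obs n =>
    gaussianReal (groupMean (ω.coef v) h.1) (ω.var v).toNNReal
  measurable' := by
    refine measurable_measure_pi _ fun v => measurable_measure_pi _ fun h => ?_
    have hm : Measurable fun ω : Latent J K =>
        (groupMean (ω.coef v) h.1, (ω.var v).toNNReal) := by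
      unfold groupMean Latent.coef Latent.var
      split_ifs <;> fun_prop
    exact measurable_gaussianReal.comp hm

instance : IsMarkovKernel (sampling J n) :=
  ⟨fun ω => by
    change IsProbabilityMeasure (Measure.pi fun v => Measure.pi fun h : Obs n =>
      gaussianReal (groupMean (ω.coef v) h.1) (ω.var v).toNNReal)
    infer_instance⟩

/-- The density of the data `d` of one node given the parameters `q = (σ², θ)` of the node. -/
def nodeLik (d : Obs n → ℝ) (q : NodeParam K) : ℝ :=
  ∏ h : Obs n, gaussianPDFReal (groupMean q.2 h.1) q.1.toNNReal (d h)

/-- The likelihood of the latent quantities given the data. -/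
def lik (D : Data J n) (ω : Latent J K) : ℝ := ∏ v, nodeLik (D v) (ω.param v)

/-- The posterior on all latent quantities given the data `D`, by Bayes' formula: its density
with respect to the prior is the likelihood divided by the marginal likelihood. -/
def posteriorLaw (D : Data J n) : Measure (Latent J K) :=
  (∫⁻ ω, ENNReal.ofReal (lik D ω) ∂P.prior)⁻¹ •
    P.prior.withDensity (fun ω => ENNReal.ofReal (lik D ω))

instance (D : Data J n) : IsFiniteMeasure (P.posteriorLaw D) := by
  refine ⟨lt_of_le_of_lt ?_ ENNReal.one_lt_top⟩
  rw [posteriorLaw, Measure.smul_apply, withDensity_apply _ MeasurableSet.univ,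
    Measure.restrict_univ, smul_eq_mul, mul_comm]
  exact ENNReal.mul_inv_le_one _

/-! #### Posterior quantities of a node -/

/-- `X(s, r) = (s 𝟙, r e_2, …, r e_G)` -/
def designMatrix (n : Fin (K + 1) → ℕ) (a : HState) : Matrix (Obs n) (Fin (K + 1)) ℝ :=
  Matrix.of fun h c =>
    if c = 0 then ((a.1 : ℕ) : ℝ) else if h.1 = c then ((a.2 : ℕ) : ℝ) else 0

/-- `Λ_j = diag(1 / τ_j, 1 / υ_j, …, 1 / υ_j)` -/
def Λ (j : ℕ) : Matrix (Fin (K + 1)) (Fin (K + 1)) ℝ :=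
  Matrix.diagonal fun c => if c = 0 then 1 / P.τj j else 1 / P.υj j

/-- The masking matrix `M(s, r)` -/
def maskMatrix (K : ℕ) (a : HState) : Matrix (Fin (K + 1)) (Fin (K + 1)) ℝ :=
  Matrix.of fun c c' =>
    if c = 0 then
      if c' = 0 then ((a.1 : ℕ) : ℝ) else ((a.1 : ℕ) : ℝ) * ((a.2 : ℕ) : ℝ)
    else
      if c' = 0 then ((a.1 : ℕ) : ℝ) * ((a.2 : ℕ) : ℝ) else ((a.2 : ℕ) : ℝ)

/-- `Λ*_j(s, r) = X(s, r)' X(s, r) + Λ_j` -/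
def Λstar (j : ℕ) (a : HState) : Matrix (Fin (K + 1)) (Fin (K + 1)) ℝ :=
  (designMatrix n a)ᵀ * designMatrix n a + P.Λ j

/-- `μ*(s, r) = Λ*(s, r)⁻¹ X(s, r)' d` -/
def μstar (D : Data J n) (v : Node J) (a : HState) : Fin (K + 1) → ℝ :=
  (P.Λstar v.1 a)⁻¹ *ᵥ ((designMatrix n a)ᵀ *ᵥ D v)

/-- `Υ(s, r) = (d'd - μ*(s, r)' Λ*(s, r) μ*(s, r)) / 2` -/
def Υ (D : Data J n) (v : Node J) (a : HState) : ℝ :=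
  (D v ⬝ᵥ D v - P.μstar D v a ⬝ᵥ (P.Λstar v.1 a *ᵥ P.μstar D v a)) / 2

/-- The total number `n = ∑ g, n_g` of observations. -/
def total (_P : NIGMG J K n) : ℝ := ((∑ g, n g : ℕ) : ℝ)

/-- The closed form of the node marginal likelihood `m_{j,k}(s, r)`. -/
def m (D : Data J n) (v : Node J) (a : HState) : ℝ :=
  (P.ν * P.σ₀sq) ^ (P.ν + 1) * Real.Gamma (P.ν + P.total / 2 + 1) /
      ((2 * Real.pi) ^ (P.total / 2) * Real.Gamma (P.ν + 1)) *
    (√(P.Λ v.1).det / √(P.Λstar v.1 a).det) *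
    (P.ν * P.σ₀sq + P.Υ D v a) ^ (-P.ν - P.total / 2 - 1)

/-! #### The pyramid recursion -/

mutual

/-- `φ_{j,k}(s, r)`, computed bottom-up. -/
def φ (P : NIGMG J K n) (D : Data J n) (v : Node J) (a : HState) : ℝ :=
  if h : (v.1 : ℕ) < J then
    P.m D v a * ξ P D (v.left h) a * ξ P D (v.right h) a
  else P.m D v a
termination_by 2 * (J - (v.1 : ℕ))
decreasing_by all_goals (simp only [Node.left, Node.right]; omega)

/-- `ξ_{j,k}(s, r)`, computed bottom-up. At the root it does not depend on `(s, r)`. -/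
def ξ (P : NIGMG J K n) (D : Data J n) (v : Node J) (a : HState) : ℝ :=
  if v = Node.root then ∑ b : HState, P.ρinit b.1 * P.κinit b.2 * φ P D v b
  else ∑ b : HState, P.ρ v a.1 b.1 * P.κ v a.2 b.2 * φ P D v b
termination_by 2 * (J - (v.1 : ℕ)) + 1
decreasing_by all_goals omega

end

/-- Posterior initial probabilities of the hidden states. -/
def postInit (D : Data J n) (a : HState) : ℝ :=
  P.ρinit a.1 * P.κinit a.2 * P.φ D Node.root a / P.ξ D Node.root (0, 0)

/-- Posterior transition probabilities of the hidden states. -/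
def postTrans (D : Data J n) (v : Node J) (a b : HState) : ℝ :=
  P.ρ v a.1 b.1 * P.κ v a.2 b.2 * P.φ D v b / P.ξ D v a

end NIGMG

end

/-! ### Densities of product measures and of images -/

section Densities

variable {ι : Type} [Fintype ι] {E : ι → Type} [∀ i, MeasurableSpace (E i)]

-- The prior and the likelihood both factor over the nodes, so Bayes' formula can be carried out
-- node by node and then transported along the tree.
--
-- At one node with hidden states `(s, r)`, the possibly degenerate coefficient prior is the image
-- of a nondegenerate normal law under the projection `proj = diag(s, r, …, r)`. The likelihood at
-- `proj θ` has mean `X(s, r) θ`. Upstairs everything has a Lebesgue density, and completing the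
-- square gives the precision `Λ*` and the mean `μ*`. Since `proj` commutes with `Λ*`, projecting
-- back keeps the mean and turns the covariance into the masked one. What remains of the likelihood
-- is, in `y = 1/σ²`, a constant times `y ^ (n/2) * exp (-Υ y)`, to which Gamma conjugacy applies.
-- In total, `nodePrior_withDensity`: prior times likelihood is `m` times a probability law
-- `nodePost`.
--
-- Multiplying over the nodes, the law of the hidden states is reweighted by `∏ m`. Each `φ` is `m`
-- times the `ξ` of the children; regrouping these `ξ` by child gives `∏ φ = ∏ m * ∏ ξ`, the last
-- product running over the nodes other than the root (`prod_φ`). As `ξ` is the row sum of the prior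
-- transitions weighted by `φ`, the reweighted tree is the constant `ξ` of the root times a Markov
-- tree (`treeProb_mul_prod_m`).
--
-- Hence the closed form `posteriorLaw_eq`: the posterior is this Markov tree composed with
-- independent node laws. The assertions on the hidden states and the parameters are read off from
-- it; marginals of the tree come from summing out nodes, deepest first. That Bayes' formula gives
-- the conditional law follows by disintegrating the joint law along the data and using uniqueness.

lemma lmarginal_prod_eval [DecidableEq ι] (μ : ∀ i, Measure (E i)) [∀ i, SigmaFinite (μ i)]
    {f : ∀ i, E i → ℝ≥0∞} (hf : ∀ i, Measurable (f i)) (s : Finset ι) (x : ∀ i, E i) :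
    (∫⋯∫⁻_s, (fun y => ∏ i, f i (y i)) ∂μ) x =
      (∏ i ∈ s, ∫⁻ y, f i y ∂μ i) * ∏ i ∈ sᶜ, f i (x i) := by
  have hm : Measurable fun y : ∀ i, E i => ∏ i, f i (y i) :=
    Finset.measurable_prod _ fun i _ => (hf i).comp (measurable_pi_apply i)
  induction s using Finset.induction_on generalizing x with
  | empty => simp
  | insert i s hi ih =>
    rw [lmarginal_insert _ hm hi]
    have hc : sᶜ = insert i (insert i s)ᶜ := by
      ext j; by_cases h : j = i <;> simp [h, hi]
    have hstep : ∀ y : E i, (∫⋯∫⁻_s, (fun y => ∏ i, f i (y i)) ∂μ) (Function.update x i y) =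
        ((∏ i ∈ s, ∫⁻ y, f i y ∂μ i) * ∏ j ∈ (insert i s)ᶜ, f j (x j)) * f i y := by
      intro y
      rw [ih, hc, Finset.prod_insert (by simp), Function.update_self]
      have : ∏ j ∈ (insert i s)ᶜ, f j (Function.update x i y j) =
          ∏ j ∈ (insert i s)ᶜ, f j (x j) := by
        refine Finset.prod_congr rfl fun j hj => ?_
        rw [Function.update_of_ne]
        rintro rfl
        simp at hj
      rw [this]
      ring
    simp_rw [hstep]
    rw [lintegral_const_mul _ (hf i), Finset.prod_insert hi]
    ring

lemma lintegral_pi_prod_eval (μ : ∀ i, Measure (E i)) [∀ i, SigmaFinite (μ i)]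
    {f : ∀ i, E i → ℝ≥0∞} (hf : ∀ i, Measurable (f i)) :
    ∫⁻ x, ∏ i, f i (x i) ∂Measure.pi μ = ∏ i, ∫⁻ y, f i y ∂μ i := by
  classical
  -- A marginal needs a base point. If there is none, some factor is empty and both sides vanish.
  rcases isEmpty_or_nonempty (∀ i, E i) with h | ⟨⟨x⟩⟩
  · obtain ⟨i, hi⟩ := isEmpty_pi.1 h
    rw [lintegral_of_isEmpty, Finset.prod_eq_zero (Finset.mem_univ i)]
    exact lintegral_of_isEmpty _ _
  · rw [lintegral_eq_lmarginal_univ x, lmarginal_prod_eval μ hf]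
    simp

/-- Boxes determine the product measure, and the indicator of a box is a product of indicators, so
the integral over a box splits. -/
lemma pi_withDensity (μ : ∀ i, Measure (E i)) [∀ i, SigmaFinite (μ i)]
    {f : ∀ i, E i → ℝ≥0∞} (hf : ∀ i, Measurable (f i))
    [∀ i, SigmaFinite ((μ i).withDensity (f i))] :
    Measure.pi (fun i => (μ i).withDensity (f i)) =
      (Measure.pi μ).withDensity fun x => ∏ i, f i (x i) := by
  refine Measure.pi_eq fun s hs => ?_
  rw [withDensity_apply _ (MeasurableSet.univ_pi hs), ← lintegral_indicator (.univ_pi hs)]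
  have : ∀ x : ∀ i, E i, (Set.univ.pi s).indicator (fun x => ∏ i, f i (x i)) x =
      ∏ i, (s i).indicator (f i) (x i) := by
    intro x
    by_cases hx : x ∈ Set.univ.pi s
    · rw [Set.indicator_of_mem hx]
      exact Finset.prod_congr rfl fun i _ => (Set.indicator_of_mem (hx i trivial) _).symm
    · rw [Set.indicator_of_notMem hx]
      simp only [Set.mem_univ_pi, not_forall] at hx
      obtain ⟨i, hi⟩ := hx
      exact (Finset.prod_eq_zero (Finset.mem_univ i) (Set.indicator_of_notMem hi _)).symm
  simp_rw [this]
  rw [lintegral_pi_prod_eval μ fun i => (hf i).indicator (hs i)]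
  exact Finset.prod_congr rfl fun i _ => by
    rw [lintegral_indicator (hs i), withDensity_apply _ (hs i)]

lemma withDensity_map {α β : Type*} [MeasurableSpace α] [MeasurableSpace β] (μ : Measure α)
    {g : α → β} (hg : Measurable g) {f : β → ℝ≥0∞} (hf : Measurable f) :
    (μ.map g).withDensity f = (μ.withDensity (f ∘ g)).map g := by
  ext s hs
  rw [withDensity_apply _ hs, setLIntegral_map hs hf hg, Measure.map_apply hg hs,
    withDensity_apply _ (hg hs)]
  rfl

end Densities

/-! ### Normal laws -/

section Normal

variable {ι : Type} [Fintype ι] [DecidableEq ι]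

/-- The law of independent standard normal variables. -/
noncomputable def stdNormal (ι : Type) [Fintype ι] : Measure (ι → ℝ) :=
  Measure.pi fun _ => gaussianReal 0 1

instance : IsProbabilityMeasure (stdNormal ι) := by unfold stdNormal; infer_instance

/-- By characteristic functions: pairing `B x` with `t` is pairing `x` with `Bᵀ t`, and `|Bᵀ t|² = t
⬝ᵥ B Bᵀ t`. Any factor `B` of the covariance will do, symmetric or not, singular or not. -/
lemma multivariateGaussian_mul_transpose (m : EuclideanSpace ℝ ι) (B : Matrix ι ι ℝ) :
    multivariateGaussian m (B * Bᵀ) =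
      (stdGaussian (EuclideanSpace ℝ ι)).map fun x => m + Matrix.toEuclideanCLM (𝕜 := ℝ) B x := by
  have hB : (B * Bᵀ).PosSemidef := by
    have := Matrix.posSemidef_self_mul_conjTranspose B
    rwa [Matrix.conjTranspose_eq_transpose_of_trivial] at this
  have : IsProbabilityMeasure ((stdGaussian (EuclideanSpace ℝ ι)).map
      fun x => m + Matrix.toEuclideanCLM (𝕜 := ℝ) B x) :=
    Measure.isProbabilityMeasure_map (by fun_prop)
  refine Measure.ext_of_charFun ?_
  ext t
  rw [charFun_multivariateGaussian hB]
  have hcomp : (fun x => m + Matrix.toEuclideanCLM (𝕜 := ℝ) B x) =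
      (m + ·) ∘ (Matrix.toEuclideanCLM (𝕜 := ℝ) B) := rfl
  rw [hcomp, ← Measure.map_map (by fun_prop) (by fun_prop), charFun_map_const_add]
  have h1 : charFun ((stdGaussian (EuclideanSpace ℝ ι)).map
      (Matrix.toEuclideanCLM (𝕜 := ℝ) B)) t =
      charFun (stdGaussian (EuclideanSpace ℝ ι)) (WithLp.toLp 2 (Bᵀ *ᵥ WithLp.ofLp t)) := by
    rw [charFun_apply, charFun_apply, integral_map (by fun_prop) (by fun_prop)]
    congr with x
    congr 3
    simp only [EuclideanSpace.inner_eq_star_dotProduct, Matrix.ofLp_toEuclideanCLM, star_trivial,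
      Matrix.dotProduct_mulVec, Matrix.mulVec_transpose]
  rw [h1, charFun_stdGaussian, ← Complex.exp_add]
  congr 1
  rw [← Complex.ofReal_pow, EuclideanSpace.real_norm_sq_eq, real_inner_comm]
  have h2 : (WithLp.ofLp t) ⬝ᵥ (B * Bᵀ) *ᵥ (WithLp.ofLp t) =
      ∑ i, (Bᵀ *ᵥ WithLp.ofLp t) i ^ 2 := by
    rw [← Matrix.mulVec_mulVec, Matrix.dotProduct_mulVec, ← Matrix.mulVec_transpose]
    simp [dotProduct, sq]
  rw [h2]
  push_cast
  ring

/-- The normal law with covariance `B Bᵀ` as an affine image of the standard normal law. -/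
lemma normalVec_mul_transpose (m : ι → ℝ) (B : Matrix ι ι ℝ) :
    normalVec m (B * Bᵀ) = (stdNormal ι).map fun x => m + B *ᵥ x := by
  rw [normalVec, multivariateGaussian_mul_transpose, ← map_pi_eq_stdGaussian,
    Measure.map_map (by fun_prop) (by fun_prop), Measure.map_map (by fun_prop) (by fun_prop)]
  rfl

lemma measurable_mulVec {κ ι : Type} [Fintype κ] [Fintype ι] (B : Matrix κ ι ℝ) :
    Measurable fun x : ι → ℝ => B *ᵥ x :=
  (Matrix.mulVecLin B).continuous_of_finiteDimensional.measurable

lemma normalVec_mul_transpose_map_mulVec (m : ι → ℝ) (B C : Matrix ι ι ℝ) :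
    (normalVec m (B * Bᵀ)).map (fun x => C *ᵥ x) = normalVec (C *ᵥ m) (C * (B * Bᵀ) * Cᵀ) := by
  have h : C * (B * Bᵀ) * Cᵀ = (C * B) * (C * B)ᵀ := by
    rw [Matrix.transpose_mul]; simp only [Matrix.mul_assoc]
  rw [h, normalVec_mul_transpose, normalVec_mul_transpose,
    Measure.map_map (measurable_mulVec C) ((measurable_mulVec B).const_add m)]
  congr 1
  ext x i
  simp [Matrix.mulVec_add, Matrix.mulVec_mulVec]

lemma stdNormal_eq_withDensity {ι : Type} [Fintype ι] :
    stdNormal ι = volume.withDensity fun x =>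
      ENNReal.ofReal ((√(2 * Real.pi))⁻¹ ^ Fintype.card ι * Real.exp (-(x ⬝ᵥ x) / 2)) := by
  have h : SigmaFinite ((volume : Measure ℝ).withDensity (gaussianPDF 0 1)) := by
    rw [← gaussianReal_of_var_ne_zero 0 one_ne_zero]; infer_instance
  have := pi_withDensity (fun _ : ι => (volume : Measure ℝ))
    (f := fun _ => gaussianPDF 0 1) (fun _ => measurable_gaussianPDF 0 1)
  rw [stdNormal]
  simp_rw [gaussianReal_of_var_ne_zero 0 one_ne_zero]
  rw [this, ← volume_pi]
  congr 1
  ext x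
  simp only [gaussianPDF]
  rw [← ENNReal.ofReal_prod_of_nonneg fun i _ => gaussianPDFReal_nonneg _ _ _]
  congr 1
  simp only [gaussianPDFReal, Finset.prod_mul_distrib, ← Real.exp_sum, Finset.prod_const,
    NNReal.coe_one, mul_one, sub_zero, Finset.card_univ]
  congr 2
  rw [← Finset.sum_div, Finset.sum_neg_distrib]
  simp [dotProduct, sq]

lemma Matrix.PosDef.exists_eq_transpose_mul_self {A : Matrix ι ι ℝ} (hA : A.PosDef) :
    ∃ C : Matrix ι ι ℝ, C.det ≠ 0 ∧ A = Cᵀ * C := by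
  open scoped MatrixOrder in
  have h := CFC.sqrt_mul_sqrt_self A hA.posSemidef.nonneg
  have hs : (CFC.sqrt A)ᵀ = CFC.sqrt A := by
    have := (CFC.sqrt_nonneg A).isSelfAdjoint
    rw [← Matrix.conjTranspose_eq_transpose_of_trivial]
    exact this
  refine ⟨CFC.sqrt A, fun h0 => hA.det_pos.ne' ?_, by rw [hs, h]⟩
  rw [← h, Matrix.det_mul, h0, zero_mul]

/-- The Lebesgue density of the normal law with covariance `t A⁻¹`. -/
lemma normalVec_eq_withDensity (m : ι → ℝ) {A : Matrix ι ι ℝ} (hA : A.PosDef) {t : ℝ}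
    (ht : 0 < t) :
    normalVec m (t • A⁻¹) = volume.withDensity fun x =>
      ENNReal.ofReal ((√(2 * Real.pi * t))⁻¹ ^ Fintype.card ι * √A.det *
        Real.exp (-((x - m) ⬝ᵥ A *ᵥ (x - m)) / (2 * t))) := by
  obtain ⟨C, hC, rfl⟩ := hA.exists_eq_transpose_mul_self
  have hCu : IsUnit C.det := isUnit_iff_ne_zero.2 hC
  have hst : √t ≠ 0 := (Real.sqrt_pos.2 ht).ne'
  have hcov : t • (Cᵀ * C)⁻¹ = (√t • C⁻¹) * (√t • C⁻¹)ᵀ := by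
    rw [Matrix.mul_inv_rev, Matrix.transpose_smul, Matrix.smul_mul, Matrix.mul_smul, smul_smul,
      Real.mul_self_sqrt ht.le, Matrix.transpose_nonsing_inv]
  have hdet : (√t • C⁻¹).det ≠ 0 := by
    rw [Matrix.det_smul, Matrix.det_nonsing_inv, Ring.inverse_eq_inv']
    positivity
  rw [hcov, normalVec_mul_transpose, stdNormal_eq_withDensity]
  set h : (ι → ℝ) → ℝ≥0∞ := fun x =>
      ENNReal.ofReal ((√(2 * Real.pi))⁻¹ ^ Fintype.card ι * Real.exp (-(x ⬝ᵥ x) / 2)) with hh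
  set f : (ι → ℝ) → ι → ℝ := fun x => m + (√t • C⁻¹) *ᵥ x with hf
  set g : (ι → ℝ) → ι → ℝ := fun y => ((√t)⁻¹ • C) *ᵥ (y - m) with hg
  have hfm : Measurable f := (measurable_mulVec _).const_add m
  have hgm : Measurable g := (measurable_mulVec _).comp (measurable_id.sub_const m)
  have hhm : Measurable h := by
    simp only [hh, dotProduct]; fun_prop
  have hgf : ∀ x, g (f x) = x := fun x => by
    simp only [hf, hg, add_sub_cancel_left, Matrix.mulVec_mulVec, Matrix.smul_mul,
      Matrix.mul_smul, smul_smul, mul_inv_cancel₀ hst, one_smul, Matrix.mul_nonsing_inv _ hCu,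
      Matrix.one_mulVec]
  have hvol : volume.map f = ENNReal.ofReal |((√t • C⁻¹).det)⁻¹| • volume := by
    have : f = (m + ·) ∘ Matrix.toLin' (√t • C⁻¹) := by
      ext x
      simp only [hf, Function.comp, Matrix.toLin'_apply]
    rw [this, ← Measure.map_map (by fun_prop)
      (LinearMap.continuous_of_finiteDimensional _).measurable,
      Real.map_matrix_volume_pi_eq_smul_volume_pi hdet, Measure.map_smul, map_add_left_eq_self]
  -- `g` inverts the affine map `f`. In this form the density passes through the image under `f`,
  -- which only rescales Lebesgue measure.
  have : volume.withDensity h = volume.withDensity ((h ∘ g) ∘ f) := by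
    congr 1; ext x; simp [hgf]
  rw [this, ← withDensity_map _ hfm (hhm.comp hgm), hvol, withDensity_smul_measure,
    ← withDensity_smul _ (hhm.comp hgm)]
  congr 1
  ext x
  simp only [Pi.smul_apply, smul_eq_mul, Function.comp, hh]
  rw [← ENNReal.ofReal_mul (abs_nonneg _), ← mul_assoc]
  congr 2
  · rw [Matrix.det_smul, Matrix.det_nonsing_inv, Ring.inverse_eq_inv', Matrix.det_mul,
      Matrix.det_transpose, Real.sqrt_mul_self_eq_abs, mul_inv, inv_inv, abs_mul, abs_inv, abs_pow,
      abs_of_nonneg (Real.sqrt_nonneg t), Real.sqrt_mul (by positivity : 0 ≤ 2 * Real.pi) t, mul_inv (√(2 * Real.pi)), mul_pow]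
    simp only [inv_pow]
    ring
  · congr 1
    have hq : g x ⬝ᵥ g x = (t)⁻¹ * ((x - m) ⬝ᵥ (Cᵀ * C) *ᵥ (x - m)) := by
      rw [← Matrix.mulVec_mulVec, Matrix.dotProduct_mulVec (x - m), Matrix.vecMul_transpose]
      simp only [hg, Matrix.smul_mulVec, smul_dotProduct, dotProduct_smul, smul_eq_mul]
      rw [← mul_assoc, ← mul_inv, Real.mul_self_sqrt ht.le]
    rw [hq]
    field_simp

/-- The normal law with mean `m` and covariance `t B Bᵀ`, as a kernel in `t`. -/
noncomputable def scaledNormal (m : ι → ℝ) (B : Matrix ι ι ℝ) : Kernel ℝ (ι → ℝ) where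
  toFun t := (stdNormal ι).map fun x => m + √t • B *ᵥ x
  -- The law is the image of one fixed measure under a map jointly measurable in `t` and `x`, so the
  -- claim reduces to the measurability of the measure of sections.
  measurable' := by
    have hm : Measurable fun p : ℝ × (ι → ℝ) => m + √p.1 • B *ᵥ p.2 :=
      (Measurable.smul (f := fun p : ℝ × (ι → ℝ) => √p.1) (by fun_prop)
        ((measurable_mulVec B).comp measurable_snd)).const_add m
    refine Measure.measurable_of_measurable_coe _ fun s hs => ?_
    have h : ∀ t : ℝ, (stdNormal ι).map (fun x => m + √t • B *ᵥ x) s =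
        stdNormal ι (Prod.mk t ⁻¹' ((fun p : ℝ × (ι → ℝ) => m + √p.1 • B *ᵥ p.2) ⁻¹' s)) :=
      fun t => Measure.map_apply (hm.comp measurable_prodMk_left) hs
    simp_rw [h]
    exact measurable_measure_prodMk_left (hm hs)

instance (m : ι → ℝ) (B : Matrix ι ι ℝ) : IsMarkovKernel (scaledNormal m B) :=
  ⟨fun t => Measure.isProbabilityMeasure_map
    (((measurable_mulVec B).const_smul (√t)).const_add m).aemeasurable⟩

/-- For negative `t` the kernel has `√t = 0` and is a point mass; variances are almost surely
positive, so this range is never charged. -/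
lemma scaledNormal_apply (m : ι → ℝ) (B : Matrix ι ι ℝ) {t : ℝ} (ht : 0 ≤ t) :
    scaledNormal m B t = normalVec m (t • (B * Bᵀ)) := by
  have h : t • (B * Bᵀ) = (√t • B) * (√t • B)ᵀ := by
    rw [Matrix.transpose_smul, Matrix.smul_mul, Matrix.mul_smul, smul_smul, Real.mul_self_sqrt ht]
  rw [h, normalVec_mul_transpose]
  simp_rw [Matrix.smul_mulVec]
  rfl

end Normal

/-! ### Reweighting a composition-product and a Gamma law -/

/-- The common form of all Bayes updates below: the mass `c a` gained by the fibre over `a` is moved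
to the first stage. The hypothesis is only almost everywhere, because normal densities are available
only at positive variance. -/
lemma compProd_withDensity_eq {α β : Type*} [MeasurableSpace α] [MeasurableSpace β]
    {μ : Measure α} [SFinite μ] {κ η : Kernel α β} [IsSFiniteKernel κ] [IsSFiniteKernel η]
    {f : α × β → ℝ≥0∞} (hf : Measurable f) {c : α → ℝ≥0∞} (hc : Measurable c)
    (h : ∀ᵐ a ∂μ, (κ a).withDensity (fun b => f (a, b)) = c a • η a) :
    (μ ⊗ₘ κ).withDensity f = (μ.withDensity c) ⊗ₘ η := by
  ext s hs
  rw [withDensity_apply _ hs, ← lintegral_indicator hs,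
    Measure.lintegral_compProd (hf.indicator hs), Measure.compProd_apply hs,
    lintegral_withDensity_eq_lintegral_mul _ hc (Kernel.measurable_kernel_prodMk_left hs)]
  refine lintegral_congr_ae ?_
  filter_upwards [h] with a ha
  have hsa : MeasurableSet (Prod.mk a ⁻¹' s) := measurable_prodMk_left hs
  have h1 : ∀ b, s.indicator f (a, b) = (Prod.mk a ⁻¹' s).indicator (fun b => f (a, b)) b :=
    fun b => rfl
  simp_rw [h1]
  rw [lintegral_indicator hsa, ← withDensity_apply _ hsa, ha]
  rfl

lemma ae_gammaMeasure_pos (a b : ℝ) : ∀ᵐ y ∂gammaMeasure a b, 0 < y := by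
  have hm : Measurable (gammaPDF a b) := (measurable_gammaPDFReal a b).ennreal_ofReal
  rw [gammaMeasure, ae_withDensity_iff hm]
  -- The density can be nonzero at `0`, since `0 ^ (a - 1) = 1` when `a = 1`; the point is discarded
  -- as a null set.
  filter_upwards [Measure.ae_ne volume (0 : ℝ)] with y hy hp
  by_contra hn
  exact hp (gammaPDF_of_neg (lt_of_le_of_ne (not_lt.1 hn) hy))

lemma ae_invGammaMeasure_pos (a b : ℝ) : ∀ᵐ t ∂invGammaMeasure a b, 0 < t := by
  rw [invGammaMeasure, ae_map_iff measurable_inv.aemeasurable measurableSet_Ioi]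
  filter_upwards [ae_gammaMeasure_pos a b] with y hy using inv_pos.2 hy

/-- Conjugacy of the Gamma law. -/
lemma gammaMeasure_withDensity {a b k u c : ℝ} (ha : 0 < a) (hb : 0 < b) (hk : 0 ≤ k) (hu : 0 ≤ u)
    (hc : 0 ≤ c) :
    (gammaMeasure a b).withDensity
        (fun y => ENNReal.ofReal (c * y ^ k * Real.exp (-(u * y)))) =
      ENNReal.ofReal (c * (b ^ a * Real.Gamma (a + k) / Real.Gamma a) *
        (b + u) ^ (-(a + k))) • gammaMeasure (a + k) (b + u) := by
  have hm : Measurable fun y : ℝ => ENNReal.ofReal (c * y ^ k * Real.exp (-(u * y))) := by fun_prop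
  have hg : ∀ a b, Measurable (gammaPDF a b) := fun a b =>
    (measurable_gammaPDFReal a b).ennreal_ofReal
  have hbu : 0 < b + u := by linarith
  have hG : 0 < Real.Gamma a := Real.Gamma_pos_of_pos ha
  have hGk : 0 < Real.Gamma (a + k) := Real.Gamma_pos_of_pos (by linarith)
  rw [gammaMeasure, gammaMeasure, ← withDensity_mul _ (hg _ _) hm, ← withDensity_smul _ (hg _ _)]
  refine withDensity_congr_ae ?_
  -- At `0` the exponents of real powers need not add.
  filter_upwards [Measure.ae_ne volume (0 : ℝ)] with y hy
  simp only [Pi.mul_apply, Pi.smul_apply, smul_eq_mul]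
  rcases lt_or_gt_of_ne hy with h | h
  · rw [gammaPDF_of_neg h, gammaPDF_of_neg h, zero_mul, mul_zero]
  · rw [gammaPDF_of_nonneg h.le, gammaPDF_of_nonneg h.le, ← ENNReal.ofReal_mul (by positivity),
      ← ENNReal.ofReal_mul (by positivity)]
    congr 1
    have h1 : y ^ (a + k - 1) = y ^ (a - 1) * y ^ k := by rw [← Real.rpow_add h]; ring_nf
    have h2 : Real.exp (-((b + u) * y)) = Real.exp (-(b * y)) * Real.exp (-(u * y)) := by
      rw [← Real.exp_add]; ring_nf
    rw [h1, h2, Real.rpow_neg hbu.le]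
    have := (Real.rpow_pos_of_pos hbu (a + k)).ne'
    field_simp

/-! ### The conjugate update of a node -/

namespace NIGMG

variable {J K : ℕ} {n : Fin (K + 1) → ℕ} (P : NIGMG J K n)

/-- The diagonal `(s, r, …, r)` of the projection onto the active coefficients. -/
def mask (K : ℕ) (a : HState) (c : Fin (K + 1)) : ℝ :=
  if c = 0 then ((a.1 : ℕ) : ℝ) else ((a.2 : ℕ) : ℝ)

lemma fin_two_mul_self (s : Fin 2) : ((s : ℕ) : ℝ) * ((s : ℕ) : ℝ) = ((s : ℕ) : ℝ) := by
  fin_cases s <;> simp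

lemma mask_mul_self (a : HState) (c : Fin (K + 1)) : mask K a c * mask K a c = mask K a c := by
  unfold mask
  split_ifs <;> exact fin_two_mul_self _

lemma maskMatrix_apply (a : HState) (c c' : Fin (K + 1)) :
    maskMatrix K a c c' = mask K a c * mask K a c' := by
  simp only [maskMatrix, mask, Matrix.of_apply]
  split_ifs <;> simp only [fin_two_mul_self, mul_comm]

/-- The projection onto the active coefficients. -/
noncomputable def proj (K : ℕ) (a : HState) : Matrix (Fin (K + 1)) (Fin (K + 1)) ℝ :=
  Matrix.diagonal (mask K a)

lemma designMatrix_mul_proj (a : HState) : designMatrix n a * proj K a = designMatrix n a := by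
  ext h c
  simp only [proj, Matrix.mul_diagonal, designMatrix, mask, Matrix.of_apply]
  split_ifs <;> simp only [fin_two_mul_self, zero_mul]

lemma proj_mul_designMatrix_transpose (a : HState) :
    proj K a * (designMatrix n a)ᵀ = (designMatrix n a)ᵀ := by
  conv_rhs => rw [← designMatrix_mul_proj a, Matrix.transpose_mul, proj,
    Matrix.diagonal_transpose]
  rfl

/-- The design sees only the active coefficients, so inactive ones may be given any law without
changing the likelihood. -/
lemma designMatrix_mulVec (a : HState) (θ : Fin (K + 1) → ℝ) (h : Obs n) :
    (designMatrix n a *ᵥ θ) h = groupMean (proj K a *ᵥ θ) h.1 := by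
  have hp : ∀ c, (proj K a *ᵥ θ) c = mask K a c * θ c := fun c => Matrix.mulVec_diagonal _ _ _
  simp only [groupMean, hp, mask]
  rw [Matrix.mulVec, dotProduct, Fin.sum_univ_succ]
  simp only [designMatrix, Matrix.of_apply, Fin.succ_ne_zero, if_false, if_true]
  congr 1
  generalize h.1 = g
  refine Fin.cases ?_ (fun g => ?_) g
  · simp [(Fin.succ_ne_zero _).symm]
  · simp [Fin.succ_ne_zero]

/-- As `s² = s` and `r² = r`, the mask matrix is the outer product of the vector `(s, r, …, r)` with
itself. -/
lemma maskMatrix_hadamard (a : HState) (A : Matrix (Fin (K + 1)) (Fin (K + 1)) ℝ) :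
    maskMatrix K a ⊙ A = proj K a * A * (proj K a)ᵀ := by
  ext c c'
  rw [Matrix.hadamard_apply, maskMatrix_apply, proj, Matrix.diagonal_transpose,
    Matrix.mul_diagonal, Matrix.diagonal_mul]
  ring

/-- Prior variance factor of an active coefficient. -/
noncomputable def scale (j : ℕ) (c : Fin (K + 1)) : ℝ := if c = 0 then P.τj j else P.υj j

lemma scale_pos (j : ℕ) (c : Fin (K + 1)) : 0 < P.scale j c := by
  have := P.τ_pos
  have := P.υ_pos
  unfold scale τj υj
  split_ifs <;> positivity

lemma Λ_eq_diagonal (j : ℕ) : P.Λ j = Matrix.diagonal fun c => (P.scale j c)⁻¹ := by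
  unfold Λ scale
  congr 1
  ext c
  split_ifs <;> simp

lemma det_Λ_pos (j : ℕ) : 0 < (P.Λ j).det := by
  rw [Λ_eq_diagonal, Matrix.det_diagonal]
  exact Finset.prod_pos fun c _ => inv_pos.2 (P.scale_pos j c)

lemma posDef_Λ (j : ℕ) : (P.Λ j).PosDef := by
  rw [Λ_eq_diagonal]
  exact Matrix.PosDef.diagonal fun c => inv_pos.2 (P.scale_pos j c)

/-- The summand `Λ` gives definiteness even when inactive states annihilate columns of the design
matrix. -/
lemma posDef_Λstar (j : ℕ) (a : HState) : (P.Λstar j a).PosDef := by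
  have h := Matrix.posSemidef_conjTranspose_mul_self (designMatrix n a)
  rw [Matrix.conjTranspose_eq_transpose_of_trivial] at h
  exact Matrix.PosDef.posSemidef_add h (P.posDef_Λ j)

lemma isUnit_det_Λstar (j : ℕ) (a : HState) : IsUnit (P.Λstar j a).det :=
  isUnit_iff_ne_zero.2 (P.posDef_Λstar j a).det_pos.ne'

/-- `XᵀX` absorbs the projection on either side and `Λ` is diagonal: `Λ*` does not couple active and
inactive coefficients. -/
lemma proj_mul_Λstar (j : ℕ) (a : HState) :
    proj K a * P.Λstar j a = P.Λstar j a * proj K a := by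
  rw [Λstar, Matrix.mul_add, Matrix.add_mul, ← Matrix.mul_assoc, proj_mul_designMatrix_transpose,
    Matrix.mul_assoc, designMatrix_mul_proj, Λ_eq_diagonal, proj, Matrix.diagonal_mul_diagonal,
    Matrix.diagonal_mul_diagonal]
  simp only [mul_comm]

lemma proj_mul_Λstar_inv (j : ℕ) (a : HState) :
    proj K a * (P.Λstar j a)⁻¹ = (P.Λstar j a)⁻¹ * proj K a := by
  have hu := P.isUnit_det_Λstar j a
  calc proj K a * (P.Λstar j a)⁻¹
      = (P.Λstar j a)⁻¹ * (P.Λstar j a * proj K a) * (P.Λstar j a)⁻¹ := by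
        rw [← Matrix.mul_assoc, Matrix.nonsing_inv_mul _ hu, Matrix.one_mul]
    _ = (P.Λstar j a)⁻¹ * proj K a := by
        rw [← proj_mul_Λstar, Matrix.mul_assoc, Matrix.mul_assoc, Matrix.mul_nonsing_inv _ hu,
          Matrix.mul_one]

lemma proj_mulVec_μstar (D : Data J n) (v : Node J) (a : HState) :
    proj K a *ᵥ P.μstar D v a = P.μstar D v a := by
  rw [μstar, Matrix.mulVec_mulVec, proj_mul_Λstar_inv, ← Matrix.mulVec_mulVec,
    Matrix.mulVec_mulVec _ (proj K a), proj_mul_designMatrix_transpose]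

lemma Λstar_mulVec_μstar (D : Data J n) (v : Node J) (a : HState) :
    P.Λstar v.1 a *ᵥ P.μstar D v a = (designMatrix n a)ᵀ *ᵥ D v := by
  rw [μstar, Matrix.mulVec_mulVec, Matrix.mul_nonsing_inv _ (P.isUnit_det_Λstar _ a),
    Matrix.one_mulVec]

/-- Completing the square. -/
lemma residual_add_penalty (D : Data J n) (v : Node J) (a : HState) (θ : Fin (K + 1) → ℝ) :
    (D v - designMatrix n a *ᵥ θ) ⬝ᵥ (D v - designMatrix n a *ᵥ θ) + θ ⬝ᵥ P.Λ v.1 *ᵥ θ =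
      2 * P.Υ D v a + (θ - P.μstar D v a) ⬝ᵥ P.Λstar v.1 a *ᵥ (θ - P.μstar D v a) := by
  have hμ := P.Λstar_mulVec_μstar D v a
  have hsymm : (P.Λstar v.1 a)ᵀ = P.Λstar v.1 a := by
    rw [← Matrix.conjTranspose_eq_transpose_of_trivial]
    exact (P.posDef_Λstar v.1 a).isHermitian
  have h1 : P.μstar D v a ⬝ᵥ P.Λstar v.1 a *ᵥ θ = θ ⬝ᵥ P.Λstar v.1 a *ᵥ P.μstar D v a := by
    rw [Matrix.dotProduct_mulVec, ← Matrix.mulVec_transpose, hsymm, dotProduct_comm]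
  have h2 : θ ⬝ᵥ (designMatrix n a)ᵀ *ᵥ D v = D v ⬝ᵥ designMatrix n a *ᵥ θ := by
    rw [Matrix.dotProduct_mulVec, Matrix.vecMul_transpose, dotProduct_comm]
  have h3 : θ ⬝ᵥ P.Λstar v.1 a *ᵥ θ =
      (designMatrix n a *ᵥ θ) ⬝ᵥ (designMatrix n a *ᵥ θ) + θ ⬝ᵥ P.Λ v.1 *ᵥ θ := by
    rw [Λstar, Matrix.add_mulVec, dotProduct_add, ← Matrix.mulVec_mulVec,
      Matrix.dotProduct_mulVec θ, Matrix.vecMul_transpose]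
  rw [Υ]
  simp only [Matrix.mulVec_sub, dotProduct_sub, sub_dotProduct]
  rw [h3, h1, hμ, h2, dotProduct_comm (designMatrix n a *ᵥ θ) (D v)]
  ring

/-- At `θ = μ*` the completed square vanishes, leaving `2 Υ` as a residual sum of squares plus a
penalty. -/
lemma Υ_nonneg (D : Data J n) (v : Node J) (a : HState) : 0 ≤ P.Υ D v a := by
  have h := P.residual_add_penalty D v a (P.μstar D v a)
  simp only [sub_self, zero_dotProduct, add_zero] at h
  have h1 := (P.posDef_Λ v.1).posSemidef.dotProduct_mulVec_nonneg (P.μstar D v a)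
  have h2 := dotProduct_star_self_nonneg (D v - designMatrix n a *ᵥ P.μstar D v a)
  simp only [star_trivial] at h1 h2
  linarith

-- Likelihood of a node and conjugate update of its coefficients and variance

lemma card_obs : Fintype.card (Obs n) = ∑ g, n g := by simp

lemma nodeLik_nonneg (d : Obs n → ℝ) (q : NodeParam K) : 0 ≤ nodeLik d q :=
  Finset.prod_nonneg fun _ _ => gaussianPDFReal_nonneg _ _ _

lemma measurable_gaussianPDFReal_comp {α : Type*} [MeasurableSpace α] {f g h : α → ℝ}
    (hf : Measurable f) (hg : Measurable g) (hh : Measurable h) :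
    Measurable fun x => gaussianPDFReal (f x) (g x).toNNReal (h x) := by
  unfold gaussianPDFReal
  fun_prop

lemma measurable_groupMean (g : Fin (K + 1)) : Measurable fun θ => groupMean (K := K) θ g := by
  unfold groupMean
  split_ifs <;> fun_prop

lemma measurable_nodeLik_uncurry :
    Measurable fun p : (Obs n → ℝ) × NodeParam K => nodeLik p.1 p.2 := by
  unfold nodeLik
  refine Finset.measurable_prod _ fun h _ => measurable_gaussianPDFReal_comp ?_ (by fun_prop)
    (by fun_prop)
  exact (measurable_groupMean h.1).comp (by fun_prop)

lemma measurable_nodeLik (d : Obs n → ℝ) : Measurable fun q : NodeParam K => nodeLik d q :=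
  measurable_nodeLik_uncurry.comp measurable_prodMk_left

lemma nodeLik_proj (d : Obs n → ℝ) (a : HState) {t : ℝ} (ht : 0 < t) (θ : Fin (K + 1) → ℝ) :
    nodeLik d (t, proj K a *ᵥ θ) = (√(2 * Real.pi * t))⁻¹ ^ (∑ g, n g) *
      Real.exp (-((d - designMatrix n a *ᵥ θ) ⬝ᵥ (d - designMatrix n a *ᵥ θ)) / (2 * t)) := by
  simp only [nodeLik, gaussianPDFReal, ← designMatrix_mulVec, Real.coe_toNNReal t ht.le,
    Finset.prod_mul_distrib, Finset.prod_const, Finset.card_univ, card_obs, ← Real.exp_sum]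
  congr 2
  rw [← Finset.sum_div, Finset.sum_neg_distrib]
  simp [dotProduct, sq]

/-- The law of the coefficients if all of them were active. -/
noncomputable def fullCoefPrior (j : ℕ) (t : ℝ) : Measure (Fin (K + 1) → ℝ) :=
  Measure.pi fun c => gaussianReal 0 (P.scale j c * t).toNNReal

/-- Zeroing the inactive coordinates multiplies each variance by the squared mask, which is the
mask. This trades a prior without Lebesgue density for one that has it. -/
lemma coefPrior_eq_map (j : ℕ) (a : HState) {t : ℝ} (ht : 0 < t) :
    P.coefPrior j a t = (P.fullCoefPrior j t).map fun θ => proj K a *ᵥ θ := by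
  have h : (fun θ : Fin (K + 1) → ℝ => proj K a *ᵥ θ) = fun θ c => mask K a c * θ c := by
    ext θ c; exact Matrix.mulVec_diagonal _ _ _
  have hc : ∀ c, gaussianReal 0 (P.coefVar j a c t).toNNReal =
      (gaussianReal 0 (P.scale j c * t).toNNReal).map (fun x => mask K a c * x) := by
    intro c
    rw [gaussianReal_map_const_mul, mul_zero]
    congr 1
    apply NNReal.coe_injective
    have hs : 0 ≤ P.scale j c * t := (mul_pos (P.scale_pos j c) ht).le
    have hv : P.coefVar j a c t = mask K a c ^ 2 * (P.scale j c * t) := by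
      rw [sq, mask_mul_self]
      unfold coefVar mask scale
      split_ifs <;> ring
    rw [NNReal.coe_mul, Real.coe_toNNReal _ hs, hv, Real.coe_toNNReal _ (by positivity)]
    rfl
  have : P.coefPrior j a t = Measure.pi fun c => gaussianReal 0 (P.coefVar j a c t).toNNReal := rfl
  rw [this, fullCoefPrior, h]
  simp_rw [hc]
  have : ∀ c, SigmaFinite ((gaussianReal 0 (P.scale j c * t).toNNReal).map
      (fun x => mask K a c * x)) := fun c => by rw [← hc]; infer_instance
  rw [Measure.pi_map_pi (fun c => (measurable_const_mul (mask K a c)).aemeasurable)]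

lemma prod_scale_inv_sqrt (j : ℕ) {t : ℝ} (ht : 0 < t) :
    ∏ c, (√(2 * Real.pi * (P.scale j c * t)))⁻¹ =
      (√(2 * Real.pi * t))⁻¹ ^ (K + 1) * √(P.Λ j).det := by
  have h : ∀ c, (√(2 * Real.pi * (P.scale j c * t)))⁻¹ =
      (√(2 * Real.pi * t))⁻¹ * √((P.scale j c)⁻¹) := fun c => by
    have := P.scale_pos j c
    rw [show 2 * Real.pi * (P.scale j c * t) = (2 * Real.pi * t) * P.scale j c by ring,
      Real.sqrt_mul (by positivity), mul_inv, Real.sqrt_inv]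
  simp_rw [h]
  rw [Finset.prod_mul_distrib, Finset.prod_const, Finset.card_univ, Fintype.card_fin,
    Λ_eq_diagonal, Matrix.det_diagonal, Real.sqrt_prod _ fun c _ => (inv_pos.2 (P.scale_pos j c)).le]

lemma fullCoefPrior_eq_withDensity (j : ℕ) {t : ℝ} (ht : 0 < t) :
    P.fullCoefPrior j t = volume.withDensity fun θ =>
      ENNReal.ofReal ((√(2 * Real.pi * t))⁻¹ ^ (K + 1) * √(P.Λ j).det *
        Real.exp (-(θ ⬝ᵥ P.Λ j *ᵥ θ) / (2 * t))) := by
  have hpos : ∀ c, 0 < P.scale j c * t := fun c => mul_pos (P.scale_pos j c) ht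
  have hv : ∀ c, (P.scale j c * t).toNNReal ≠ 0 := fun c => (Real.toNNReal_pos.2 (hpos c)).ne'
  have h : ∀ c, SigmaFinite
      ((volume : Measure ℝ).withDensity (gaussianPDF 0 (P.scale j c * t).toNNReal)) := fun c => by
    rw [← gaussianReal_of_var_ne_zero 0 (hv c)]; infer_instance
  have := pi_withDensity (fun _ : Fin (K + 1) => (volume : Measure ℝ))
    (f := fun c => gaussianPDF 0 (P.scale j c * t).toNNReal) (fun _ => measurable_gaussianPDF _ _)
  rw [fullCoefPrior]
  simp_rw [fun c => gaussianReal_of_var_ne_zero 0 (hv c)]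
  rw [this, ← volume_pi]
  congr 1
  ext θ
  simp only [gaussianPDF]
  rw [← ENNReal.ofReal_prod_of_nonneg fun i _ => gaussianPDFReal_nonneg _ _ _]
  congr 1
  simp only [gaussianPDFReal, Finset.prod_mul_distrib, ← Real.exp_sum,
    fun c => Real.coe_toNNReal _ (hpos c).le]
  rw [P.prod_scale_inv_sqrt j ht]
  congr 2
  rw [Λ_eq_diagonal]
  simp only [dotProduct, Matrix.mulVec_diagonal]
  rw [← Finset.sum_neg_distrib, Finset.sum_div]
  refine Finset.sum_congr rfl fun c _ => ?_
  have := (P.scale_pos j c).ne'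
  field_simp
  ring

/-- The marginal likelihood of a node given its hidden states and its variance `t`. -/
noncomputable def condMarginal (D : Data J n) (v : Node J) (a : HState) (t : ℝ) : ℝ :=
  (√(2 * Real.pi * t))⁻¹ ^ (∑ g, n g) * (√(P.Λ v.1).det / √(P.Λstar v.1 a).det) *
    Real.exp (-P.Υ D v a / t)

/-- A factored covariance is what `scaledNormal` needs to give a kernel in the variance. -/
lemma exists_coefFactor (j : ℕ) (a : HState) : ∃ B : Matrix (Fin (K + 1)) (Fin (K + 1)) ℝ,
    maskMatrix K a ⊙ (P.Λstar j a)⁻¹ = B * Bᵀ := by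
  obtain ⟨C, -, hC⟩ := (P.posDef_Λstar j a).inv.exists_eq_transpose_mul_self
  refine ⟨proj K a * Cᵀ, ?_⟩
  rw [maskMatrix_hadamard, hC, Matrix.transpose_mul, Matrix.transpose_transpose]
  simp only [Matrix.mul_assoc]

/-- Lift to the nondegenerate prior, complete the square there, and project. The lifted posterior
has covariance `t Λ*⁻¹`; the projection fixes `μ*` and masks this covariance. -/
lemma coefPrior_withDensity (D : Data J n) (v : Node J) (a : HState) {t : ℝ} (ht : 0 < t) :
    (P.coefPrior v.1 a t).withDensity (fun θ => ENNReal.ofReal (nodeLik (D v) (t, θ))) =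
      ENNReal.ofReal (P.condMarginal D v a t) •
        normalVec (P.μstar D v a) (t • (maskMatrix K a ⊙ (P.Λstar v.1 a)⁻¹)) := by
  have hmeas : Measurable fun θ => ENNReal.ofReal (nodeLik (D v) (t, θ)) :=
    ((measurable_nodeLik (D v)).comp measurable_prodMk_left).ennreal_ofReal
  have hproj : Measurable fun θ => proj K a *ᵥ θ := measurable_mulVec _
  have hdet := (P.posDef_Λstar v.1 a).det_pos
  have hd : Measurable fun θ : Fin (K + 1) → ℝ =>
      ENNReal.ofReal ((√(2 * Real.pi * t))⁻¹ ^ (K + 1) * √(P.Λ v.1).det *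
        Real.exp (-(θ ⬝ᵥ P.Λ v.1 *ᵥ θ) / (2 * t))) := by
    have := measurable_mulVec (P.Λ v.1)
    simp only [dotProduct]
    fun_prop
  have hd' : Measurable fun θ : Fin (K + 1) → ℝ =>
      ENNReal.ofReal ((√(2 * Real.pi * t))⁻¹ ^ Fintype.card (Fin (K + 1)) * √(P.Λstar v.1 a).det *
        Real.exp (-((θ - P.μstar D v a) ⬝ᵥ P.Λstar v.1 a *ᵥ (θ - P.μstar D v a)) / (2 * t))) := by
    have := measurable_mulVec (P.Λstar v.1 a)
    simp only [dotProduct]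
    fun_prop
  obtain ⟨C, -, hC⟩ := ((P.posDef_Λstar v.1 a).inv.smul ht).exists_eq_transpose_mul_self
  have hfull : (P.fullCoefPrior v.1 t).withDensity
        ((fun θ => ENNReal.ofReal (nodeLik (D v) (t, θ))) ∘ fun θ => proj K a *ᵥ θ) =
      ENNReal.ofReal (P.condMarginal D v a t) •
        normalVec (P.μstar D v a) (t • (P.Λstar v.1 a)⁻¹) := by
    rw [fullCoefPrior_eq_withDensity _ _ ht, normalVec_eq_withDensity _ (P.posDef_Λstar v.1 a) ht,
      ← withDensity_mul _ hd (hmeas.comp hproj), ← withDensity_smul _ hd']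
    congr 1
    ext θ
    simp only [Pi.mul_apply, Pi.smul_apply, smul_eq_mul, Function.comp]
    rw [← ENNReal.ofReal_mul (by positivity),
      ← ENNReal.ofReal_mul (by unfold condMarginal; positivity), nodeLik_proj _ _ ht]
    congr 1
    have hexp : Real.exp (-(θ ⬝ᵥ P.Λ v.1 *ᵥ θ) / (2 * t)) *
        Real.exp (-((D v - designMatrix n a *ᵥ θ) ⬝ᵥ (D v - designMatrix n a *ᵥ θ)) / (2 * t)) =
        Real.exp (-P.Υ D v a / t) * Real.exp (-((θ - P.μstar D v a) ⬝ᵥ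
          P.Λstar v.1 a *ᵥ (θ - P.μstar D v a)) / (2 * t)) := by
      rw [← Real.exp_add, ← Real.exp_add]
      congr 1
      have := P.residual_add_penalty D v a θ
      field_simp
      linarith
    have hs : √(P.Λstar v.1 a).det ≠ 0 := (Real.sqrt_pos.2 hdet).ne'
    rw [condMarginal, Fintype.card_fin]
    calc _ = (√(2 * Real.pi * t))⁻¹ ^ (K + 1) * √(P.Λ v.1).det *
          (√(2 * Real.pi * t))⁻¹ ^ (∑ g, n g) * (Real.exp (-(θ ⬝ᵥ P.Λ v.1 *ᵥ θ) / (2 * t)) *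
        Real.exp (-((D v - designMatrix n a *ᵥ θ) ⬝ᵥ (D v - designMatrix n a *ᵥ θ)) / (2 * t))) := by
          ring
      _ = _ := by
          rw [hexp]
          field_simp
  rw [coefPrior_eq_map _ _ _ ht, withDensity_map _ hproj hmeas, hfull, Measure.map_smul, hC]
  have := normalVec_mul_transpose_map_mulVec (P.μstar D v a) Cᵀ (proj K a)
  rw [Matrix.transpose_transpose] at this
  rw [this, proj_mulVec_μstar, ← hC, maskMatrix_hadamard, Matrix.mul_smul, Matrix.smul_mul]

/-- A square root of the posterior covariance of the coefficients at unit variance. -/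
noncomputable def coefFactor (j : ℕ) (a : HState) : Matrix (Fin (K + 1)) (Fin (K + 1)) ℝ :=
  (P.exists_coefFactor j a).choose

/-- The posterior law of the coefficients of a node given its hidden states, as a kernel in its
variance. -/
noncomputable def coefPost (D : Data J n) (v : Node J) (a : HState) :
    Kernel ℝ (Fin (K + 1) → ℝ) :=
  scaledNormal (P.μstar D v a) (P.coefFactor v.1 a)

instance (D : Data J n) (v : Node J) (a : HState) : IsMarkovKernel (P.coefPost D v a) := by
  unfold coefPost; infer_instance

lemma coefPost_apply (D : Data J n) (v : Node J) (a : HState) {t : ℝ} (ht : 0 ≤ t) :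
    P.coefPost D v a t =
      normalVec (P.μstar D v a) (t • (maskMatrix K a ⊙ (P.Λstar v.1 a)⁻¹)) := by
  rw [coefPost, scaledNormal_apply _ _ ht, (P.exists_coefFactor v.1 a).choose_spec]
  rfl

/-- The posterior law of the variance of a node given its hidden states. -/
noncomputable def varPost (D : Data J n) (v : Node J) (a : HState) : Measure ℝ :=
  invGammaMeasure (P.ν + 1 + P.total / 2) (P.ν * P.σ₀sq + P.Υ D v a)

lemma total_nonneg : 0 ≤ P.total := by unfold total; positivity

lemma rate_pos (D : Data J n) (v : Node J) (a : HState) : 0 < P.ν * P.σ₀sq + P.Υ D v a :=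
  add_pos_of_pos_of_nonneg (mul_pos P.ν_pos P.σ₀sq_pos) (P.Υ_nonneg D v a)

instance (D : Data J n) (v : Node J) (a : HState) : IsProbabilityMeasure (P.varPost D v a) :=
  isProbabilityMeasure_invGammaMeasure
    (by have := P.ν_pos; have := P.total_nonneg; positivity) (P.rate_pos D v a)

/-- The posterior law of the parameters of a node given its hidden states. -/
noncomputable def nodePost (D : Data J n) (v : Node J) (a : HState) : Measure (NodeParam K) :=
  P.varPost D v a ⊗ₘ P.coefPost D v a

instance (D : Data J n) (v : Node J) (a : HState) : IsProbabilityMeasure (P.nodePost D v a) := by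
  unfold nodePost; infer_instance

lemma m_pos (D : Data J n) (v : Node J) (a : HState) : 0 < P.m D v a := by
  have h1 := P.ν_pos
  have h2 := P.σ₀sq_pos
  have h3 := P.total_nonneg
  have h4 := P.rate_pos D v a
  have h5 := P.det_Λ_pos v.1
  have h6 := (P.posDef_Λstar v.1 a).det_pos
  have h7 : 0 < Real.Gamma (P.ν + P.total / 2 + 1) := Real.Gamma_pos_of_pos (by positivity)
  have h8 : 0 < Real.Gamma (P.ν + 1) := Real.Gamma_pos_of_pos (by positivity)
  unfold m
  positivity

lemma measurable_condMarginal (D : Data J n) (v : Node J) (a : HState) :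
    Measurable (P.condMarginal D v a) := by
  unfold condMarginal
  fun_prop

/-- In the precision `y = 1/t` the conditional marginal likelihood is a constant times `y ^ (n/2) *
exp (-Υ y)`. This is Gamma conjugacy, and the normalising constant that appears is `m`. -/
lemma invGamma_withDensity_condMarginal (D : Data J n) (v : Node J) (a : HState) :
    (invGammaMeasure (P.ν + 1) (P.ν * P.σ₀sq)).withDensity
        (fun t => ENNReal.ofReal (P.condMarginal D v a t)) =
      ENNReal.ofReal (P.m D v a) • P.varPost D v a := by
  have h1 := P.ν_pos
  have h2 := P.σ₀sq_pos
  have h3 := P.total_nonneg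
  rw [invGammaMeasure, withDensity_map _ measurable_inv
    (P.measurable_condMarginal D v a).ennreal_ofReal]
  have hcongr : (gammaMeasure (P.ν + 1) (P.ν * P.σ₀sq)).withDensity
        ((fun t => ENNReal.ofReal (P.condMarginal D v a t)) ∘ fun y => y⁻¹) =
      (gammaMeasure (P.ν + 1) (P.ν * P.σ₀sq)).withDensity (fun y => ENNReal.ofReal
        (((2 * Real.pi) ^ (P.total / 2))⁻¹ * (√(P.Λ v.1).det / √(P.Λstar v.1 a).det) *
          y ^ (P.total / 2) * Real.exp (-(P.Υ D v a * y)))) := by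
    refine withDensity_congr_ae ?_
    filter_upwards [ae_gammaMeasure_pos _ _] with y hy
    simp only [Function.comp, condMarginal]
    congr 1
    have hpow : (√(2 * Real.pi * y⁻¹))⁻¹ ^ (∑ g, n g) =
        ((2 * Real.pi) ^ (P.total / 2))⁻¹ * y ^ (P.total / 2) := by
      have hx : ∀ x : ℝ, 0 ≤ x → √x ^ (∑ g, n g) = x ^ (P.total / 2) := fun x hx => by
        rw [Real.sqrt_eq_rpow, ← Real.rpow_natCast, ← Real.rpow_mul hx]
        unfold total
        ring_nf
      rw [inv_pow, hx _ (by positivity), Real.mul_rpow (by positivity) (by positivity),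
        Real.inv_rpow hy.le, mul_inv, inv_inv]
    rw [hpow, div_inv_eq_mul]
    ring_nf
  rw [hcongr, gammaMeasure_withDensity (by positivity) (by positivity) (by positivity)
    (P.Υ_nonneg D v a) (by positivity), Measure.map_smul, varPost, invGammaMeasure]
  congr 2
  unfold m
  rw [show P.ν + P.total / 2 + 1 = P.ν + 1 + P.total / 2 by ring,
    show -P.ν - P.total / 2 - 1 = -(P.ν + 1 + P.total / 2) by ring]
  ring

/-- The conjugate update of a node. -/
lemma nodePrior_withDensity (D : Data J n) (v : Node J) (a : HState) :
    (P.nodePrior v a).withDensity (fun q => ENNReal.ofReal (nodeLik (D v) q)) =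
      ENNReal.ofReal (P.m D v a) • P.nodePost D v a := by
  have : IsProbabilityMeasure (invGammaMeasure (P.ν + 1) (P.ν * P.σ₀sq)) :=
    isProbabilityMeasure_invGammaMeasure (by linarith [P.ν_pos]) (mul_pos P.ν_pos P.σ₀sq_pos)
  rw [nodePrior, compProd_withDensity_eq (measurable_nodeLik (D v)).ennreal_ofReal
    (P.measurable_condMarginal D v a).ennreal_ofReal (η := P.coefPost D v a),
    invGamma_withDensity_condMarginal, Measure.compProd_smul_left, nodePost]
  filter_upwards [ae_invGammaMeasure_pos _ _] with t ht
  rw [P.coefPost_apply D v a ht.le, ← P.coefPrior_withDensity D v a ht]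

lemma lintegral_nodeLik (D : Data J n) (v : Node J) (a : HState) :
    ∫⁻ q, ENNReal.ofReal (nodeLik (D v) q) ∂(P.nodePrior v a) = ENNReal.ofReal (P.m D v a) := by
  rw [← setLIntegral_univ, ← withDensity_apply _ .univ, nodePrior_withDensity,
    Measure.smul_apply, measure_univ, smul_eq_mul, mul_one]

end NIGMG

/-! ### Combinatorics of the tree -/

namespace Node

variable {J : ℕ}

lemma eq_of_val {v w : Node J} (h1 : (v.1 : ℕ) = w.1) (h2 : (v.2 : ℕ) = w.2) : v = w := by
  obtain ⟨⟨j, hj⟩, ⟨k, hk⟩⟩ := v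
  obtain ⟨⟨j', hj'⟩, ⟨k', hk'⟩⟩ := w
  simp only at h1 h2
  subst h1
  subst h2
  rfl

lemma root_level : ((root : Node J).1 : ℕ) = 0 := rfl

lemma eq_root_of_level {v : Node J} (h : (v.1 : ℕ) = 0) : v = root := by
  refine eq_of_val h ?_
  have h1 := v.2.2
  have h2 : 2 ^ (v.1 : ℕ) = 1 := by rw [h, pow_zero]
  change (v.2 : ℕ) = 0
  omega

lemma level_pos {v : Node J} (h : v ≠ root) : 0 < (v.1 : ℕ) :=
  Nat.pos_of_ne_zero fun h0 => h (eq_root_of_level h0)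

lemma parent_level {v : Node J} : (v.parent.1 : ℕ) = v.1 - 1 := rfl

lemma parent_level_lt {v : Node J} (h : v ≠ root) : (v.parent.1 : ℕ) < v.1 := by
  have := level_pos h
  rw [parent_level]
  omega

lemma parent_ne {v : Node J} (h : v ≠ root) : v.parent ≠ v := fun he => by
  have := parent_level_lt h
  rw [he] at this
  exact lt_irrefl _ this

/-- A product over the children of a node. -/
lemma prod_children {M : Type*} [CommMonoid M] (v : Node J) (f : Node J → M) :
    ∏ u ∈ (Finset.univ.filter fun u : Node J => u ≠ root).filter (fun u => u.parent = v), f u =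
      if h : (v.1 : ℕ) < J then f (v.left h) * f (v.right h) else 1 := by
  split_ifs with h
  · have hne : v.left h ≠ v.right h := fun he => by
      have h1 := congrArg (fun w : Node J => (w.2 : ℕ)) he
      simp only [left, right] at h1
      omega
    rw [← Finset.prod_pair hne]
    refine Finset.prod_congr ?_ fun _ _ => rfl
    ext u
    simp only [Finset.mem_filter, Finset.mem_univ, true_and, Finset.mem_insert,
      Finset.mem_singleton]
    constructor
    · rintro ⟨hu, rfl⟩
      have hl := level_pos hu
      rcases Nat.even_or_odd' (u.2 : ℕ) with ⟨c, hc | hc⟩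
      · left
        refine eq_of_val ?_ ?_
        · change (u.1 : ℕ) = u.1 - 1 + 1; omega
        · change (u.2 : ℕ) = 2 * (u.2 / 2); omega
      · right
        refine eq_of_val ?_ ?_
        · change (u.1 : ℕ) = u.1 - 1 + 1; omega
        · change (u.2 : ℕ) = 2 * (u.2 / 2) + 1; omega
    · rintro (rfl | rfl)
      · refine ⟨fun he => ?_, eq_of_val ?_ ?_⟩
        · have := congrArg (fun w : Node J => (w.1 : ℕ)) he
          simp [left, root] at this
        · change (v.1 : ℕ) + 1 - 1 = v.1; omega
        · change 2 * (v.2 : ℕ) / 2 = v.2; omega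
      · refine ⟨fun he => ?_, eq_of_val ?_ ?_⟩
        · have := congrArg (fun w : Node J => (w.1 : ℕ)) he
          simp [right, root] at this
        · change (v.1 : ℕ) + 1 - 1 = v.1; omega
        · change (2 * (v.2 : ℕ) + 1) / 2 = v.2; omega
  · refine Finset.prod_eq_one fun u hu => ?_
    simp only [Finset.mem_filter, Finset.mem_univ, true_and] at hu
    obtain ⟨hu, rfl⟩ := hu
    have h1 := level_pos hu
    have h2 := u.1.2
    rw [parent_level] at h
    omega

end Node

/-! ### Marginals of a Markov tree -/

section MarkovTree

/-- The map `(x, b) ↦ (update x v b, x v)` is an involution. The factor `card S` is the price of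
keeping all sums over full configurations while a coordinate is summed out. -/
lemma sum_sum_update {V S : Type} [Fintype V] [DecidableEq V] [Fintype S] (v : V)
    (F : (V → S) → ℝ) :
    ∑ x, ∑ b, F (Function.update x v b) = Fintype.card S * ∑ x, F x := by
  let e : (V → S) × S ≃ (V → S) × S :=
    { toFun := fun p => (Function.update p.1 v p.2, p.1 v)
      invFun := fun p => (Function.update p.1 v p.2, p.1 v)
      left_inv := fun p => by simp
      right_inv := fun p => by simp }
  have h1 : ∑ x, ∑ b, F (Function.update x v b) = ∑ p : (V → S) × S, F (e p).1 :=
    (Fintype.sum_prod_type fun p : (V → S) × S => F (e p).1).symm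
  rw [h1, Equiv.sum_comp e (fun p => F p.1), Fintype.sum_prod_type]
  simp [Finset.mul_sum]

variable {J : ℕ} {S : Type} [Fintype S] {init : S → ℝ} {trans : Node J → S → S → ℝ}

/-- The part of `treeProb` that comes from the root and the nodes in `A`. -/
def partialProb (init : S → ℝ) (trans : Node J → S → S → ℝ) (A : Finset (Node J))
    (x : Node J → S) : ℝ :=
  init (x Node.root) * ∏ v ∈ A.filter (fun v => v ≠ Node.root), trans v (x v.parent) (x v)

/-- By `hA`, no node of `A` is a child of `v`, so among the factors of `partialProb` only that of
`v` itself involves the state of `v`. -/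
lemma sum_partialProb_insert {A : Finset (Node J)} {v : Node J} (hv : v ≠ Node.root)
    (hvA : v ∉ A) (hA : ∀ u ∈ A, u ≠ Node.root → u.parent ≠ v) {g : (Node J → S) → ℝ}
    (hg : ∀ x b, g (Function.update x v b) = g x) (h : S → ℝ) :
    Fintype.card S * ∑ x, partialProb init trans (insert v A) x * (g x * h (x v)) =
      ∑ x, partialProb init trans A x * g x * ∑ b, trans v (x v.parent) b * h b := by
  rw [← sum_sum_update v]
  refine Finset.sum_congr rfl fun x _ => ?_
  rw [Finset.mul_sum]
  refine Finset.sum_congr rfl fun b _ => ?_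
  have hprod : ∏ u ∈ A.filter (fun u => u ≠ Node.root),
        trans u (Function.update x v b u.parent) (Function.update x v b u) =
      ∏ u ∈ A.filter (fun u => u ≠ Node.root), trans u (x u.parent) (x u) := by
    refine Finset.prod_congr rfl fun u hu => ?_
    rw [Finset.mem_filter] at hu
    rw [Function.update_of_ne (hA u hu.1 hu.2),
      Function.update_of_ne (ne_of_mem_of_not_mem hu.1 hvA)]
  rw [partialProb, partialProb, Finset.filter_insert, if_pos hv,
    Finset.prod_insert (fun hmem => hvA (Finset.mem_filter.1 hmem).1), hprod, hg,
    Function.update_of_ne hv.symm, Function.update_of_ne (Node.parent_ne hv), Function.update_self]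
  ring

/-- Summing out the nodes outside a set of nodes that is closed under taking parents. -/
lemma sum_partialProb_eq (hs : ∀ v, v ≠ Node.root → ∀ a, ∑ b, trans v a b = 1)
    {A : Finset (Node J)} (hroot : Node.root ∈ A)
    (hA : ∀ v ∈ A, v ≠ Node.root → v.parent ∈ A) {g : (Node J → S) → ℝ}
    (hg : ∀ v ∉ A, ∀ x b, g (Function.update x v b) = g x) (k : ℕ) :
    ∀ B : Finset (Node J), A ⊆ B → (B \ A).card = k →
      (Fintype.card S : ℝ) ^ k * ∑ x, partialProb init trans B x * g x =
        ∑ x, partialProb init trans A x * g x := by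
  induction k with
  | zero =>
    intro B hAB hk
    rw [Finset.card_eq_zero, Finset.sdiff_eq_empty_iff_subset] at hk
    rw [hAB.antisymm hk]
    simp
  | succ k ih =>
    intro B hAB hk
    have hne : (B \ A).Nonempty := Finset.card_pos.1 (by omega)
    -- A deepest node of `B \ A` has no child in `B`: a child would be deeper, and could not lie in
    -- `A`, which contains the parents of its nodes. Its transition row can therefore be summed to
    -- `1`.
    obtain ⟨v, hvm, hmax⟩ := Finset.exists_max_image (B \ A) (fun v => (v.1 : ℕ)) hne
    obtain ⟨hvB, hvA⟩ := Finset.mem_sdiff.1 hvm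
    have hv : v ≠ Node.root := fun he => hvA (he ▸ hroot)
    have hcard : (B.erase v \ A).card = k := by
      rw [Finset.erase_sdiff_comm, Finset.card_erase_of_mem hvm, hk]
      rfl
    have hAe : A ⊆ B.erase v := fun u hu =>
      Finset.mem_erase.2 ⟨fun he => hvA (he ▸ hu), hAB hu⟩
    have hpar : ∀ u ∈ B.erase v, u ≠ Node.root → u.parent ≠ v := by
      rintro u hu hur rfl
      have huB := (Finset.mem_erase.1 hu).2
      have huA : u ∉ A := fun h => hvA (hA u h hur)
      have := hmax u (Finset.mem_sdiff.2 ⟨huB, huA⟩)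
      exact absurd this (not_le.2 (Node.parent_level_lt hur))
    have hstep := sum_partialProb_insert (init := init) (trans := trans) hv
      (Finset.notMem_erase v B) hpar (hg v hvA) (fun _ => 1)
    simp only [mul_one, hs v hv] at hstep
    rw [Finset.insert_erase hvB] at hstep
    rw [pow_succ, mul_assoc, hstep, ih _ hAe hcard]

lemma IsStochasticTree.card_pos (h : IsStochasticTree init trans) : 0 < Fintype.card S := by
  rw [Fintype.card_pos_iff]
  by_contra hn
  rw [not_nonempty_iff] at hn
  simpa using h.init_sum

lemma IsStochasticTree.treeProb_nonneg (h : IsStochasticTree init trans) (x : Node J → S) :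
    0 ≤ treeProb init trans x :=
  mul_nonneg (h.init_nonneg _) (Finset.prod_nonneg fun v hv =>
    h.trans_nonneg v (Finset.mem_filter.1 hv).2 _ _)

/-- The law of the state of the root. -/
lemma IsStochasticTree.sum_treeProb_root (h : IsStochasticTree init trans) (f : S → ℝ) :
    ∑ x, treeProb init trans x * f (x Node.root) = ∑ b, init b * f b := by
  have hc : (Fintype.card S : ℝ) ≠ 0 := Nat.cast_ne_zero.2 h.card_pos.ne'
  have h1 := sum_partialProb_eq (init := init) (trans := trans) h.trans_sum
    (A := {Node.root}) (by simp) (by simp) (g := fun x => f (x Node.root))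
    (fun v hv x b => by rw [Function.update_of_ne (ne_of_mem_of_not_mem (Finset.mem_singleton_self _) hv)]) _ Finset.univ
    (Finset.subset_univ _) rfl
  have h2 : ∀ x, partialProb init trans {Node.root} x = init (x Node.root) := fun x => by
    simp [partialProb, Finset.filter_singleton]
  -- A function of the root state alone, summed over all configurations, also carries a power of
  -- `card S`; `h4` matches it with the power in `h1`.
  have h3 := sum_sum_update (Node.root : Node J) (fun x : Node J → S =>
    init (x Node.root) * f (x Node.root))
  simp only [Function.update_self, Finset.sum_const, Finset.card_univ, nsmul_eq_mul,
    Fintype.card_fun] at h3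
  have h4 : (Finset.univ \ {Node.root} : Finset (Node J)).card + 1 = Fintype.card (Node J) := by
    rw [← Finset.compl_eq_univ_sdiff, Finset.card_compl, Finset.card_singleton]
    exact Nat.sub_add_cancel Fintype.card_pos
  simp only [h2] at h1
  rw [← h1, ← h4] at h3
  push_cast at h3
  rw [← mul_assoc, ← pow_succ'] at h3
  exact (mul_left_cancel₀ (pow_ne_zero _ hc) h3).symm

lemma IsStochasticTree.sum_treeProb (h : IsStochasticTree init trans) :
    ∑ x, treeProb init trans x = 1 := by
  have := h.sum_treeProb_root fun _ => 1
  simpa [h.init_sum] using this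

/-- The joint law of the states of a node and of its parent. -/
lemma IsStochasticTree.sum_treeProb_trans [DecidableEq S] (h : IsStochasticTree init trans)
    {v : Node J} (hv : v ≠ Node.root) (a b : S) :
    ∑ x, treeProb init trans x * ((if x v.parent = a then 1 else 0) * if x v = b then 1 else 0) =
      trans v a b * ∑ x, treeProb init trans x * if x v.parent = a then 1 else 0 := by
  have hc : (Fintype.card S : ℝ) ≠ 0 := Nat.cast_ne_zero.2 h.card_pos.ne'
  -- The strictly shallower nodes contain the parent of `v` but not `v`. Both `A` and `insert v A`
  -- are closed under parents, so the remaining nodes sum out in each case.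
  let A : Finset (Node J) := Finset.univ.filter fun u => (u.1 : ℕ) < v.1
  have hmem : ∀ u, u ∈ A ↔ (u.1 : ℕ) < v.1 := fun u => by simp [A]
  have hvA : v ∉ A := fun hm => lt_irrefl _ ((hmem v).1 hm)
  have hroot : Node.root ∈ A := (hmem _).2 (by rw [Node.root_level]; exact Node.level_pos hv)
  have hpA : v.parent ∈ A := (hmem _).2 (Node.parent_level_lt hv)
  have hA : ∀ u ∈ A, u ≠ Node.root → u.parent ∈ A := fun u hu hur =>
    (hmem _).2 ((Node.parent_level_lt hur).trans ((hmem u).1 hu))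
  have hA' : ∀ u ∈ insert v A, u ≠ Node.root → u.parent ∈ insert v A := fun u hu hur => by
    rcases Finset.mem_insert.1 hu with rfl | hu
    · exact Finset.mem_insert_of_mem hpA
    · exact Finset.mem_insert_of_mem (hA u hu hur)
  have h1 := sum_partialProb_eq (init := init) (trans := trans) h.trans_sum hroot hA
    (g := fun x => if x v.parent = a then 1 else 0)
    (fun u hu x b => by
      rw [Function.update_of_ne (ne_of_mem_of_not_mem hpA hu)]) _ Finset.univ (Finset.subset_univ _) rfl
  have h2 := sum_partialProb_eq (init := init) (trans := trans) h.trans_sum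
    (Finset.mem_insert_of_mem hroot) hA'
    (g := fun x => (if x v.parent = a then 1 else 0) * if x v = b then 1 else 0)
    (fun u hu x b => by
      rw [Function.update_of_ne (ne_of_mem_of_not_mem (Finset.mem_insert_of_mem hpA) hu),
        Function.update_of_ne (ne_of_mem_of_not_mem (Finset.mem_insert_self v A) hu)]) _ Finset.univ
      (Finset.subset_univ _) rfl
  have h3 := sum_partialProb_insert (init := init) (trans := trans) hv hvA
    (fun u hu hur he => hvA (he ▸ hA u hu hur))
    (g := fun x => if x v.parent = a then 1 else 0)
    (fun x b => by rw [Function.update_of_ne (Node.parent_ne hv)])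
    (fun c => if c = b then 1 else 0)
  have h4 : ∀ x : Node J → S, partialProb init trans A x * (if x v.parent = a then 1 else 0) *
      (∑ c, trans v (x v.parent) c * if c = b then 1 else 0) =
      trans v a b * (partialProb init trans A x * if x v.parent = a then 1 else 0) := fun x => by
    by_cases hx : x v.parent = a
    · simp [hx]; ring
    · simp [hx]
  simp only [h4] at h3
  rw [← Finset.mul_sum, ← h1, ← h2] at h3
  -- One node fewer is summed out over `insert v A`; the factor `card S` in `h3` makes up for it.
  have hcard : (Finset.univ \ A).card = (Finset.univ \ insert v A).card + 1 := by
    rw [← Finset.compl_eq_univ_sdiff, ← Finset.compl_eq_univ_sdiff, Finset.compl_insert,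
      Finset.card_erase_add_one (Finset.mem_compl.2 hvA)]
  rw [hcard, ← mul_assoc, ← pow_succ', mul_left_comm] at h3
  exact mul_left_cancel₀ (pow_ne_zero _ hc) h3

end MarkovTree

/-! ### The pyramid recursion -/

namespace NIGMG

variable {J K : ℕ} {n : Fin (K + 1) → ℕ} (P : NIGMG J K n)

lemma ξ_root (D : Data J n) (a : HState) :
    P.ξ D Node.root a = ∑ b : HState, P.ρinit b.1 * P.κinit b.2 * P.φ D Node.root b := by
  rw [ξ, if_pos rfl]

lemma ξ_of_ne_root (D : Data J n) {v : Node J} (hv : v ≠ Node.root) (a : HState) :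
    P.ξ D v a = ∑ b : HState, P.ρ v a.1 b.1 * P.κ v a.2 b.2 * P.φ D v b := by
  rw [ξ, if_neg hv]

/-- Nonnegative weights of total mass `1` cannot all vanish, so an average of positive numbers is
positive. -/
lemma sum_mul_pos {w f : HState → ℝ} {p q : Fin 2 → ℝ} (hw : ∀ b, w b = p b.1 * q b.2)
    (hp : ∀ b, 0 ≤ p b) (hq : ∀ b, 0 ≤ q b) (hps : ∑ b, p b = 1) (hqs : ∑ b, q b = 1)
    (hf : ∀ b, 0 < f b) : 0 < ∑ b, w b * f b := by
  have hw0 : ∀ b, 0 ≤ w b := fun b => by rw [hw]; exact mul_nonneg (hp _) (hq _)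
  have hs : ∑ b, w b = 1 := by
    simp only [hw, Fintype.sum_prod_type, ← Finset.mul_sum, hqs, mul_one, hps]
  refine lt_of_le_of_ne (Finset.sum_nonneg fun b _ => mul_nonneg (hw0 b) (hf b).le) fun h0 => ?_
  have h := (Finset.sum_eq_zero_iff_of_nonneg fun b _ => mul_nonneg (hw0 b) (hf b).le).1 h0.symm
  have hz : ∀ b, w b = 0 := fun b =>
    (mul_eq_zero.1 (h b (Finset.mem_univ b))).resolve_right (hf b).ne'
  simp [hz] at hs

lemma ξ_pos_of_φ_pos (D : Data J n) (v : Node J) (hφ : ∀ b, 0 < P.φ D v b) (a : HState) :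
    0 < P.ξ D v a := by
  by_cases hv : v = Node.root
  · subst hv
    rw [ξ_root]
    exact sum_mul_pos (fun _ => rfl) P.ρ_stochastic.init_nonneg P.κ_stochastic.init_nonneg
      P.ρ_stochastic.init_sum P.κ_stochastic.init_sum hφ
  · rw [P.ξ_of_ne_root D hv]
    exact sum_mul_pos (p := P.ρ v a.1) (q := P.κ v a.2) (fun _ => rfl)
      (P.ρ_stochastic.trans_nonneg v hv _) (P.κ_stochastic.trans_nonneg v hv _)
      (P.ρ_stochastic.trans_sum v hv _) (P.κ_stochastic.trans_sum v hv _) hφ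

/-- Induction from the leaves upwards. Strict positivity is what permits dividing by `ξ`, whatever
zeros the prior transitions have. -/
lemma φ_pos (D : Data J n) (v : Node J) (a : HState) : 0 < P.φ D v a := by
  induction hk : J - (v.1 : ℕ) generalizing v a with
  | zero =>
    rw [φ, dif_neg (by omega)]
    exact P.m_pos D v a
  | succ k ih =>
    have h : (v.1 : ℕ) < J := by omega
    rw [φ, dif_pos h]
    have hl : J - ((v.left h).1 : ℕ) = k := by simp only [Node.left]; omega
    have hr : J - ((v.right h).1 : ℕ) = k := by simp only [Node.right]; omega
    exact mul_pos (mul_pos (P.m_pos D v a) (P.ξ_pos_of_φ_pos D _ (fun b => ih _ b hl) a))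
      (P.ξ_pos_of_φ_pos D _ (fun b => ih _ b hr) a)

lemma ξ_pos (D : Data J n) (v : Node J) (a : HState) : 0 < P.ξ D v a :=
  P.ξ_pos_of_φ_pos D v (P.φ_pos D v) a

/-- `ξ` is by construction the sum of the numerators. -/
lemma isStochasticTree_post (D : Data J n) :
    IsStochasticTree (P.postInit D) (P.postTrans D) where
  init_nonneg a := div_nonneg (mul_nonneg (mul_nonneg (P.ρ_stochastic.init_nonneg _)
    (P.κ_stochastic.init_nonneg _)) (P.φ_pos D _ a).le) (P.ξ_pos D _ _).le
  init_sum := by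
    unfold postInit
    rw [← Finset.sum_div, ← P.ξ_root D (0, 0), div_self (P.ξ_pos D _ _).ne']
  trans_nonneg v hv a b := div_nonneg (mul_nonneg (mul_nonneg
    (P.ρ_stochastic.trans_nonneg v hv _ _) (P.κ_stochastic.trans_nonneg v hv _ _))
    (P.φ_pos D _ b).le) (P.ξ_pos D _ _).le
  trans_sum v hv a := by
    unfold postTrans
    rw [← Finset.sum_div, ← P.ξ_of_ne_root D hv, div_self (P.ξ_pos D _ _).ne']

/-- The factor `ξ` of a child `u` occurs in `φ` of its parent, evaluated at the parent's state.
Grouping the nodes other than the root by their parent collects each such factor once. -/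
lemma prod_φ (D : Data J n) (x : Node J → HState) :
    ∏ v, P.φ D v (x v) = (∏ v, P.m D v (x v)) *
      ∏ v ∈ Finset.univ.filter (fun v : Node J => v ≠ Node.root), P.ξ D v (x v.parent) := by
  have h : ∀ v, P.φ D v (x v) = P.m D v (x v) *
      ∏ u ∈ (Finset.univ.filter fun u : Node J => u ≠ Node.root).filter (fun u => u.parent = v),
        P.ξ D u (x u.parent) := by
    intro v
    have h1 : ∏ u ∈ (Finset.univ.filter fun u : Node J => u ≠ Node.root).filter
          (fun u => u.parent = v), P.ξ D u (x u.parent) =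
        ∏ u ∈ (Finset.univ.filter fun u : Node J => u ≠ Node.root).filter
          (fun u => u.parent = v), P.ξ D u (x v) :=
      Finset.prod_congr rfl fun u hu => by rw [(Finset.mem_filter.1 hu).2]
    rw [h1, Node.prod_children, φ]
    split_ifs
    · ring
    · ring
  rw [Finset.prod_congr rfl fun v _ => h v, Finset.prod_mul_distrib, Finset.prod_fiberwise]

/-- The prior weight of a configuration times its marginal likelihood, in terms of the posterior
Markov tree. -/
lemma treeProb_mul_prod_m (D : Data J n) (x : Node J → HState) :
    treeProb P.ρinit P.ρ (fun v => (x v).1) * treeProb P.κinit P.κ (fun v => (x v).2) *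
        ∏ v, P.m D v (x v) =
      P.ξ D Node.root (0, 0) * treeProb (P.postInit D) (P.postTrans D) x := by
  have hφ := P.prod_φ D x
  have hne : ∏ v ∈ Finset.univ.filter (fun v : Node J => v ≠ Node.root),
      P.ξ D v (x v.parent) ≠ 0 := Finset.prod_ne_zero_iff.2 fun v _ => (P.ξ_pos D _ _).ne'
  have hsplit : ∏ v, P.φ D v (x v) = P.φ D Node.root (x Node.root) *
      ∏ v ∈ Finset.univ.filter (fun v : Node J => v ≠ Node.root), P.φ D v (x v) := by
    rw [← Finset.mul_prod_erase _ _ (Finset.mem_univ (Node.root : Node J))]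
    congr 1
    exact Finset.prod_congr (by ext; simp) fun _ _ => rfl
  have h0 := (P.ξ_pos D Node.root (0, 0)).ne'
  simp only [treeProb, postInit, postTrans, Finset.prod_div_distrib, Finset.prod_mul_distrib]
  rw [hsplit] at hφ
  field_simp
  -- The coefficient is, up to sign, the prior weight of the configuration; it multiplies the
  -- identity of `prod_φ`.
  linear_combination (-1 : ℝ) * (P.ρinit (x Node.root).1 * P.κinit (x Node.root).2 *
    (∏ v ∈ Finset.univ.filter (fun v : Node J => v ≠ Node.root),
      P.ρ v (x v.parent).1 (x v).1) *
    (∏ v ∈ Finset.univ.filter (fun v : Node J => v ≠ Node.root),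
      P.κ v (x v.parent).2 (x v).2)) * hφ

end NIGMG

/-! ### Markov trees as measures -/

section MarkovTreeMeasure

variable {J : ℕ} {S : Type} [Fintype S] [DecidableEq S] [MeasurableSpace S]
  [MeasurableSingletonClass S] {init : S → ℝ} {trans : Node J → S → S → ℝ}

lemma markovTree_singleton (x : Node J → S) :
    markovTree init trans {x} = ENNReal.ofReal (treeProb init trans x) := by
  simp only [markovTree, Measure.coe_finsetSum, Finset.sum_apply, Measure.smul_apply, smul_eq_mul,
    Measure.dirac_apply, Set.indicator_apply, Set.mem_singleton_iff, Pi.one_apply]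
  rw [Finset.sum_eq_single x (fun y _ hy => by simp [hy]) (by simp)]
  simp

lemma IsStochasticTree.markovTree_apply (h : IsStochasticTree init trans)
    (p : (Node J → S) → Prop) [DecidablePred p] :
    markovTree init trans {x | p x} =
      ENNReal.ofReal (∑ x, treeProb init trans x * if p x then 1 else 0) := by
  rw [ENNReal.ofReal_sum_of_nonneg fun x _ =>
    mul_nonneg (h.treeProb_nonneg x) (by split_ifs <;> norm_num)]
  simp only [markovTree, Measure.coe_finsetSum, Finset.sum_apply, Measure.smul_apply, smul_eq_mul,
    Measure.dirac_apply, Set.indicator_apply, Set.mem_ofPred_eq, Pi.one_apply]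
  refine Finset.sum_congr rfl fun x _ => ?_
  split_ifs <;> simp

lemma IsStochasticTree.isProbabilityMeasure (h : IsStochasticTree init trans) :
    IsProbabilityMeasure (markovTree init trans) := by
  refine ⟨?_⟩
  have := h.markovTree_apply fun _ => True
  simpa [h.sum_treeProb] using this

end MarkovTreeMeasure

/-! ### Conditioning on discrete variables -/

/-- Evaluating the disintegration on `{b} ×ˢ s` shows that at an atom the kernel is the elementary
conditional law. -/
lemma cond_map_of_map_eq_compProd {Ω β γ : Type*} [MeasurableSpace Ω] [MeasurableSpace β]
    [MeasurableSpace γ] [MeasurableSingletonClass β] {μ : Measure Ω} [IsFiniteMeasure μ]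
    {X : Ω → β} {Y : Ω → γ} (hX : Measurable X) (hY : Measurable Y) {κ : Kernel β γ}
    [IsSFiniteKernel κ] (h : μ.map (fun ω => (X ω, Y ω)) = μ.map X ⊗ₘ κ) {b : β}
    (hb : μ (X ⁻¹' {b}) ≠ 0) :
    (μ[|X ⁻¹' {b}]).map Y = κ b := by
  ext s hs
  have h1 : μ (X ⁻¹' {b} ∩ Y ⁻¹' s) = μ (X ⁻¹' {b}) * κ b s := by
    have h2 : X ⁻¹' {b} ∩ Y ⁻¹' s = (fun ω => (X ω, Y ω)) ⁻¹' ({b} ×ˢ s) := rfl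
    rw [h2, ← Measure.map_apply (hX.prodMk hY) ((measurableSet_singleton b).prod hs), h,
      Measure.compProd_apply_prod (measurableSet_singleton b) hs, lintegral_singleton,
      Measure.map_apply hX (measurableSet_singleton b), mul_comm]
  rw [Measure.map_apply hY hs, cond_apply (hX (measurableSet_singleton b)), h1, ← mul_assoc,
    ENNReal.inv_mul_cancel hb (measure_ne_top _ _), one_mul]

/-- Used with `a` the hidden states, `b` the variance and `c` the coefficients of a node: the second
stage `τ a` of the law of `(b, c)` given `a` is the law of `c` given both `a` and `b`. -/
lemma compProd_map_swap_assoc {α β γ : Type*} [MeasurableSpace α] [MeasurableSpace β]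
    [MeasurableSpace γ] (μ : Measure α) [SFinite μ] {κ : Kernel α (β × γ)} [IsMarkovKernel κ]
    {η : Kernel (β × α) γ} [IsMarkovKernel η] {ν : α → Measure β} [∀ a, SFinite (ν a)]
    {τ : α → Kernel β γ} [∀ a, IsMarkovKernel (τ a)] (hκ : ∀ a, κ a = ν a ⊗ₘ τ a)
    (hη : ∀ b a, η (b, a) = τ a b) :
    (μ ⊗ₘ κ).map (fun p => ((p.2.1, p.1), p.2.2)) =
      (μ ⊗ₘ κ).map (fun p => (p.2.1, p.1)) ⊗ₘ η := by
  have hf : Measurable fun p : α × β × γ => ((p.2.1, p.1), p.2.2) := by fun_prop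
  have hg : Measurable fun p : α × β × γ => (p.2.1, p.1) := by fun_prop
  ext s hs
  have hG := Kernel.measurable_kernel_prodMk_left (κ := η) hs
  have hGg : Measurable fun p : α × β × γ => η (p.2.1, p.1) (Prod.mk (p.2.1, p.1) ⁻¹' s) :=
    hG.comp hg
  rw [Measure.map_apply hf hs, Measure.compProd_apply (hf hs), Measure.compProd_apply hs,
    lintegral_map hG hg, Measure.lintegral_compProd hGg]
  refine lintegral_congr fun a => ?_
  rw [hκ, Measure.compProd_apply (measurable_prodMk_left (hf hs)),
    Measure.lintegral_compProd (f := fun q : β × γ => η (q.1, a) (Prod.mk (q.1, a) ⁻¹' s))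
      (hGg.comp measurable_prodMk_left)]
  refine lintegral_congr fun b => ?_
  simp only [lintegral_const, measure_univ, mul_one, hη]
  rfl

lemma pi_smul_measure {ι : Type} [Fintype ι] {E : ι → Type} [∀ i, MeasurableSpace (E i)]
    (μ : ∀ i, Measure (E i)) [∀ i, IsFiniteMeasure (μ i)] (c : ι → ℝ≥0∞) (hc : ∀ i, c i ≠ ∞) :
    Measure.pi (fun i => c i • μ i) = (∏ i, c i) • Measure.pi μ := by
  have : ∀ i, IsFiniteMeasure (c i • μ i) := fun i => (μ i).smul_finite (hc i)
  refine Measure.pi_eq fun s _ => ?_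
  simp only [Measure.smul_apply, Measure.pi_pi, smul_eq_mul, Finset.prod_mul_distrib]

/-! ### The posterior law -/

namespace NIGMG

variable {J K : ℕ} {n : Fin (K + 1) → ℕ} (P : NIGMG J K n)

lemma statePrior_singleton (x : Node J → HState) :
    P.statePrior {x} = ENNReal.ofReal (treeProb P.ρinit P.ρ (fun v => (x v).1) *
      treeProb P.κinit P.κ (fun v => (x v).2)) := by
  rw [statePrior, Measure.map_apply (by fun_prop) (measurableSet_singleton x)]
  have : (fun (p : (Node J → Fin 2) × (Node J → Fin 2)) v => (p.1 v, p.2 v)) ⁻¹' {x} =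
      {fun v => (x v).1} ×ˢ {fun v => (x v).2} := by
    ext p
    simp only [Set.mem_preimage, Set.mem_singleton_iff, Set.mem_prod, funext_iff, Prod.ext_iff]
    exact forall_and
  rw [this, Measure.prod_prod, markovTree_singleton, markovTree_singleton,
    ENNReal.ofReal_mul (P.ρ_stochastic.treeProb_nonneg _)]

/-- The posterior law of the parameters of all nodes given all hidden states. -/
noncomputable def paramPost (D : Data J n) : Kernel (Node J → HState) (Node J → NodeParam K) :=
  Kernel.ofFunOfCountable fun x => Measure.pi fun v => P.nodePost D v (x v)

lemma paramPost_apply (D : Data J n) (x : Node J → HState) :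
    P.paramPost D x = Measure.pi fun v => P.nodePost D v (x v) := rfl

lemma paramPrior_apply (x : Node J → HState) :
    P.paramPrior x = Measure.pi fun v => P.nodePrior v (x v) := rfl

instance (D : Data J n) : IsMarkovKernel (P.paramPost D) :=
  ⟨fun x => by rw [paramPost_apply]; infer_instance⟩

lemma measurable_state (v : Node J) : Measurable (Latent.state (K := K) v) := by
  unfold Latent.state; fun_prop

lemma measurable_param (v : Node J) : Measurable (Latent.param (K := K) v) := by
  unfold Latent.param; fun_prop

lemma measurable_var (v : Node J) : Measurable (Latent.var (K := K) v) := by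
  unfold Latent.var; fun_prop

lemma measurable_coef (v : Node J) : Measurable (Latent.coef (K := K) v) := by
  unfold Latent.coef; fun_prop

lemma measurable_lik_uncurry :
    Measurable fun p : Data J n × Latent J K => lik p.1 p.2 := by
  have h : ∀ v : Node J, Measurable fun p : Data J n × Latent J K =>
      nodeLik (p.1 v) (p.2.param v) := fun v =>
    Measurable.comp (g := fun p : (Obs n → ℝ) × NodeParam K => nodeLik p.1 p.2)
      (f := fun p : Data J n × Latent J K => (p.1 v, p.2.param v)) measurable_nodeLik_uncurry
      (((measurable_pi_apply v).comp measurable_fst).prodMk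
        ((measurable_param v).comp measurable_snd))
  unfold lik
  exact Finset.measurable_prod Finset.univ fun v _ => h v

lemma measurable_lik (D : Data J n) : Measurable fun ω : Latent J K => lik D ω :=
  Measurable.comp (g := fun p : Data J n × Latent J K => lik p.1 p.2) (f := Prod.mk D)
    measurable_lik_uncurry measurable_prodMk_left

/-- Given the states, prior and likelihood are products over the nodes, so the node updates
multiply. -/
lemma paramPrior_withDensity (D : Data J n) (x : Node J → HState) :
    (P.paramPrior x).withDensity (fun θ => ENNReal.ofReal (lik D (x, θ))) =
      ENNReal.ofReal (∏ v, P.m D v (x v)) • P.paramPost D x := by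
  have hfin : ∀ v, SigmaFinite ((P.nodePrior v (x v)).withDensity
      fun q => ENNReal.ofReal (nodeLik (D v) q)) := fun v => by
    rw [nodePrior_withDensity]
    have := (P.nodePost D v (x v)).smul_finite (ENNReal.ofReal_ne_top (r := P.m D v (x v)))
    infer_instance
  have h := pi_withDensity (fun v => P.nodePrior v (x v))
    (f := fun v q => ENNReal.ofReal (nodeLik (D v) q))
    (fun v => (measurable_nodeLik (D v)).ennreal_ofReal)
  have hlik : (fun θ : Node J → NodeParam K => ENNReal.ofReal (lik D (x, θ))) =
      fun θ => ∏ v, ENNReal.ofReal (nodeLik (D v) (θ v)) := by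
    ext θ
    rw [← ENNReal.ofReal_prod_of_nonneg fun v _ => nodeLik_nonneg _ _]
    rfl
  rw [paramPrior_apply, hlik, ← h]
  simp_rw [nodePrior_withDensity]
  rw [pi_smul_measure _ _ fun v => ENNReal.ofReal_ne_top,
    ENNReal.ofReal_prod_of_nonneg fun v _ => (P.m_pos D v _).le, paramPost_apply]

lemma statePrior_withDensity (D : Data J n) :
    P.statePrior.withDensity (fun x => ENNReal.ofReal (∏ v, P.m D v (x v))) =
      ENNReal.ofReal (P.ξ D Node.root (0, 0)) • markovTree (P.postInit D) (P.postTrans D) := by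
  refine Measure.ext_of_singleton fun x => ?_
  rw [withDensity_apply _ (measurableSet_singleton x), lintegral_singleton, statePrior_singleton,
    Measure.smul_apply, markovTree_singleton, smul_eq_mul,
    ← ENNReal.ofReal_mul (P.ξ_pos D _ _).le, ← treeProb_mul_prod_m,
    ← ENNReal.ofReal_mul (Finset.prod_nonneg fun v _ => (P.m_pos D v _).le), mul_comm]

lemma isProbabilityMeasure_postTree (D : Data J n) :
    IsProbabilityMeasure (markovTree (P.postInit D) (P.postTrans D)) :=
  (P.isStochasticTree_post D).isProbabilityMeasure

lemma prior_withDensity (D : Data J n) :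
    P.prior.withDensity (fun ω => ENNReal.ofReal (lik D ω)) =
      ENNReal.ofReal (P.ξ D Node.root (0, 0)) •
        (markovTree (P.postInit D) (P.postTrans D) ⊗ₘ P.paramPost D) := by
  rw [prior, compProd_withDensity_eq (measurable_lik D).ennreal_ofReal
    (c := fun x => ENNReal.ofReal (∏ v, P.m D v (x v))) (measurable_of_countable _)
    (η := P.paramPost D) (.of_forall (P.paramPrior_withDensity D)), statePrior_withDensity,
    Measure.compProd_smul_left]

/-- The marginal likelihood. -/
lemma lintegral_lik (D : Data J n) :
    ∫⁻ ω, ENNReal.ofReal (lik D ω) ∂P.prior = ENNReal.ofReal (P.ξ D Node.root (0, 0)) := by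
  have := P.isProbabilityMeasure_postTree D
  rw [← setLIntegral_univ, ← withDensity_apply _ .univ, prior_withDensity,
    Measure.smul_apply, measure_univ, smul_eq_mul, mul_one]

/-- The reweighted prior is `ξ` of the root times a probability measure, so that constant is the
marginal likelihood and cancels. -/
lemma posteriorLaw_eq (D : Data J n) :
    P.posteriorLaw D = markovTree (P.postInit D) (P.postTrans D) ⊗ₘ P.paramPost D := by
  rw [posteriorLaw, lintegral_lik, prior_withDensity, smul_smul, ENNReal.inv_mul_cancel
    (ENNReal.ofReal_pos.2 (P.ξ_pos D _ _)).ne' ENNReal.ofReal_ne_top, one_smul]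

lemma isProbabilityMeasure_posteriorLaw (D : Data J n) :
    IsProbabilityMeasure (P.posteriorLaw D) := by
  have := P.isProbabilityMeasure_postTree D
  rw [posteriorLaw_eq]
  infer_instance

lemma posteriorLaw_map_fst (D : Data J n) :
    (P.posteriorLaw D).map Prod.fst = markovTree (P.postInit D) (P.postTrans D) := by
  rw [posteriorLaw_eq]
  exact Measure.fst_compProd _ _

/-- The posterior probability of an event about the hidden states. -/
lemma posteriorLaw_states (D : Data J n) (p : (Node J → HState) → Prop) [DecidablePred p] :
    P.posteriorLaw D (Prod.fst ⁻¹' {x | p x}) = ENNReal.ofReal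
      (∑ x, treeProb (P.postInit D) (P.postTrans D) x * if p x then 1 else 0) := by
  rw [← (P.isStochasticTree_post D).markovTree_apply, ← posteriorLaw_map_fst,
    Measure.map_apply measurable_fst (Set.toFinite _).measurableSet]

lemma posteriorLaw_root (D : Data J n) (a : HState) :
    P.posteriorLaw D (Latent.state Node.root ⁻¹' {a}) = ENNReal.ofReal (P.postInit D a) := by
  have h := P.posteriorLaw_states D fun x => x Node.root = a
  have h' := (P.isStochasticTree_post D).sum_treeProb_root fun b => if b = a then 1 else 0
  rw [h'] at h
  simp only [mul_ite, mul_one, mul_zero, Finset.sum_ite_eq', Finset.mem_univ, if_true] at h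
  exact h

lemma posteriorLaw_trans (D : Data J n) {v : Node J} (hv : v ≠ Node.root) (a b : HState)
    (h0 : P.posteriorLaw D (Latent.state v.parent ⁻¹' {a}) ≠ 0) :
    (P.posteriorLaw D)[Latent.state v ⁻¹' {b} | Latent.state v.parent ⁻¹' {a}] =
      ENNReal.ofReal (P.postTrans D v a b) := by
  have h1 := P.posteriorLaw_states D fun x => x v.parent = a
  have h2 := P.posteriorLaw_states D fun x => x v.parent = a ∧ x v = b
  have h3 := (P.isStochasticTree_post D).sum_treeProb_trans hv a b
  have h4 : ∀ x : Node J → HState, (if x v.parent = a ∧ x v = b then (1 : ℝ) else 0) =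
      (if x v.parent = a then 1 else 0) * if x v = b then 1 else 0 := fun x => by
    split_ifs <;> simp_all
  simp only [h4] at h2
  rw [h3, ENNReal.ofReal_mul ((P.isStochasticTree_post D).trans_nonneg v hv a b), ← h1] at h2
  rw [cond_apply (measurable_state _ (measurableSet_singleton a))]
  change _ * P.posteriorLaw D (Prod.fst ⁻¹' {x | x v.parent = a ∧ x v = b}) = _
  change P.posteriorLaw D (Prod.fst ⁻¹' {x | x v.parent = a}) ≠ 0 at h0
  rw [h2]
  change (P.posteriorLaw D (Prod.fst ⁻¹' {x | x v.parent = a}))⁻¹ * _ = _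
  rw [mul_left_comm, ENNReal.inv_mul_cancel h0 (measure_ne_top _ _), mul_one]

/-- `nodePost` as a kernel in the hidden states. -/
noncomputable def nodePostKernel (D : Data J n) (v : Node J) : Kernel HState (NodeParam K) :=
  Kernel.ofFunOfCountable (P.nodePost D v)

lemma nodePostKernel_apply (D : Data J n) (v : Node J) (a : HState) :
    P.nodePostKernel D v a = P.nodePost D v a := rfl

instance (D : Data J n) (v : Node J) : IsMarkovKernel (P.nodePostKernel D v) :=
  ⟨fun a => by rw [nodePostKernel_apply]; infer_instance⟩

/-- The joint posterior law of the hidden states and the parameters of a node. -/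
lemma posteriorLaw_map_state_param (D : Data J n) (v : Node J) :
    (P.posteriorLaw D).map (fun ω => (Latent.state v ω, Latent.param v ω)) =
      (P.posteriorLaw D).map (Latent.state v) ⊗ₘ P.nodePostKernel D v := by
  have hsp := (measurable_state (K := K) v).prodMk (measurable_param v)
  have hst : (P.posteriorLaw D).map (Latent.state v) =
      (markovTree (P.postInit D) (P.postTrans D)).map fun x => x v := by
    rw [← posteriorLaw_map_fst, Measure.map_map (measurable_pi_apply v) measurable_fst]
    rfl
  ext s hs
  rw [Measure.map_apply hsp hs, Measure.compProd_apply hs, hst,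
    lintegral_map (Kernel.measurable_kernel_prodMk_left hs) (measurable_pi_apply v),
    posteriorLaw_eq, Measure.compProd_apply (hsp hs)]
  refine lintegral_congr fun x => ?_
  have hm : MeasurableSet (Prod.mk (x v) ⁻¹' s) := measurable_prodMk_left hs
  -- The marginal at `v` of the product law depends on the configuration only through `x v`.
  rw [paramPost_apply, nodePostKernel_apply,
    ← (measurePreserving_eval (fun v => P.nodePost D v (x v)) v).measure_preimage
      hm.nullMeasurableSet]
  rfl

lemma condDistrib_param (D : Data J n) (v : Node J) :
    condDistrib (Latent.param v) (Latent.state v) (P.posteriorLaw D)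
      =ᵐ[(P.posteriorLaw D).map (Latent.state v)] P.nodePostKernel D v :=
  condDistrib_ae_eq_of_measure_eq_compProd _ (measurable_param v).aemeasurable
    (P.posteriorLaw_map_state_param D v)

lemma condDistrib_var (D : Data J n) (v : Node J) :
    ∀ᵐ a ∂((P.posteriorLaw D).map (Latent.state v)),
      condDistrib (Latent.var v) (Latent.state v) (P.posteriorLaw D) a = P.varPost D v a := by
  filter_upwards [P.condDistrib_param D v, condDistrib_comp (μ := P.posteriorLaw D)
    (Latent.state v) (measurable_param v).aemeasurable measurable_fst] with a h1 h2
  have : (Latent.var v : Latent J K → ℝ) = Prod.fst ∘ Latent.param v := rfl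
  rw [this, h2, Kernel.map_apply _ measurable_fst, h1, nodePostKernel_apply, nodePost]
  exact Measure.fst_compProd _ _

/-- `coefPost` as a kernel in the variance and the hidden states. -/
noncomputable def coefPostKernel (D : Data J n) (v : Node J) :
    Kernel (ℝ × HState) (Fin (K + 1) → ℝ) where
  toFun q := P.coefPost D v q.2 q.1
  measurable' := measurable_from_prod_countable_left fun a => (P.coefPost D v a).measurable

lemma coefPostKernel_apply (D : Data J n) (v : Node J) (q : ℝ × HState) :
    P.coefPostKernel D v q = P.coefPost D v q.2 q.1 := rfl

instance (D : Data J n) (v : Node J) : IsMarkovKernel (P.coefPostKernel D v) :=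
  ⟨fun q => by rw [coefPostKernel_apply]; infer_instance⟩

lemma posteriorLaw_map_var_state_coef (D : Data J n) (v : Node J) :
    (P.posteriorLaw D).map (fun ω => ((Latent.var v ω, Latent.state v ω), Latent.coef v ω)) =
      (P.posteriorLaw D).map (fun ω => (Latent.var v ω, Latent.state v ω)) ⊗ₘ
        P.coefPostKernel D v := by
  have hsp := (measurable_state (K := K) v).prodMk (measurable_param v)
  have hf : Measurable fun p : HState × NodeParam K => ((p.2.1, p.1), p.2.2) := by fun_prop
  have hg : Measurable fun p : HState × NodeParam K => (p.2.1, p.1) := by fun_prop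
  have h1 : (P.posteriorLaw D).map
      (fun ω => ((Latent.var v ω, Latent.state v ω), Latent.coef v ω)) =
      ((P.posteriorLaw D).map (Latent.state v) ⊗ₘ P.nodePostKernel D v).map
        fun p : HState × NodeParam K => ((p.2.1, p.1), p.2.2) := by
    rw [← posteriorLaw_map_state_param, Measure.map_map hf hsp]
    rfl
  have h2 : (P.posteriorLaw D).map (fun ω => (Latent.var v ω, Latent.state v ω)) =
      ((P.posteriorLaw D).map (Latent.state v) ⊗ₘ P.nodePostKernel D v).map
        fun p : HState × NodeParam K => (p.2.1, p.1) := by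
    rw [← posteriorLaw_map_state_param, Measure.map_map hg hsp]
    rfl
  rw [h1, h2]
  exact compProd_map_swap_assoc _ (ν := P.varPost D v) (τ := P.coefPost D v) (fun _ => rfl)
    fun _ _ => rfl

lemma ae_nodePost_pos (D : Data J n) (v : Node J) (a : HState) :
    ∀ᵐ q ∂P.nodePost D v a, 0 < q.1 :=
  Measure.ae_compProd_of_ae_fst _ measurableSet_Ioi (ae_invGammaMeasure_pos _ _)

lemma ae_posteriorLaw_var_pos (D : Data J n) (v : Node J) :
    ∀ᵐ ω ∂P.posteriorLaw D, 0 < Latent.var v ω := by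
  have hsp := (measurable_state (K := K) v).prodMk (measurable_param v)
  have hset : MeasurableSet {p : HState × NodeParam K | 0 < p.2.1} :=
    measurableSet_lt measurable_const (by fun_prop)
  have h : ∀ᵐ p ∂((P.posteriorLaw D).map (fun ω => (Latent.state v ω, Latent.param v ω))),
      0 < p.2.1 := by
    rw [posteriorLaw_map_state_param]
    exact Measure.ae_compProd_of_ae_ae hset (.of_forall fun a => P.ae_nodePost_pos D v a)
  exact (ae_map_iff hsp.aemeasurable hset).1 h

lemma condDistrib_coef (D : Data J n) (v : Node J) :
    ∀ᵐ q ∂((P.posteriorLaw D).map (fun ω => (Latent.var v ω, Latent.state v ω))),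
      condDistrib (Latent.coef v) (fun ω => (Latent.var v ω, Latent.state v ω))
          (P.posteriorLaw D) q =
        normalVec (P.μstar D v q.2) (q.1 • (maskMatrix K q.2 ⊙ (P.Λstar v.1 q.2)⁻¹)) := by
  have hvs := (measurable_var (K := K) v).prodMk (measurable_state v)
  have hset : MeasurableSet {q : ℝ × HState | 0 < q.1} :=
    measurableSet_lt measurable_const (by fun_prop)
  filter_upwards [condDistrib_ae_eq_of_measure_eq_compProd _ (measurable_coef v).aemeasurable
    (P.posteriorLaw_map_var_state_coef D v),
    (ae_map_iff hvs.aemeasurable hset).2 (P.ae_posteriorLaw_var_pos D v)] with q h1 h2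
  rw [h1, coefPostKernel_apply, P.coefPost_apply D v q.2 (le_of_lt h2)]

/-- Given all hidden states, the parameters of the nodes are independent. -/
lemma posteriorLaw_cond_states (D : Data J n) (x : Node J → HState)
    (hx : P.posteriorLaw D (Prod.fst ⁻¹' {x}) ≠ 0) :
    ((P.posteriorLaw D)[|Prod.fst ⁻¹' {x}]).map Prod.snd =
      Measure.pi fun v =>
        ((P.posteriorLaw D)[|Latent.state v ⁻¹' {x v}]).map (Latent.param v) := by
  have h : (P.posteriorLaw D).map (fun ω => (ω.1, ω.2)) =
      (P.posteriorLaw D).map Prod.fst ⊗ₘ P.paramPost D := by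
    rw [posteriorLaw_map_fst, ← posteriorLaw_eq]
    exact Measure.map_id
  have hv : ∀ v, ((P.posteriorLaw D)[|Latent.state v ⁻¹' {x v}]).map (Latent.param v) =
      P.nodePost D v (x v) := fun v => by
    -- The event on one node contains the event that fixes the whole configuration.
    have hne : P.posteriorLaw D (Latent.state v ⁻¹' {x v}) ≠ 0 := fun h0 =>
      hx (measure_mono_null (fun ω hω => congrFun hω v) h0)
    exact cond_map_of_map_eq_compProd (measurable_state v) (measurable_param v)
      (P.posteriorLaw_map_state_param D v) hne
  simp_rw [hv]
  rw [cond_map_of_map_eq_compProd measurable_fst measurable_snd h hx, paramPost_apply]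

/-! ### Bayes' formula -/

/-- Where `σ² ≤ 0`, truncation gives variance `0` and `gaussianReal` is a point mass; off this null
set the likelihood is a true density of the data. -/
lemma ae_prior_var_pos : ∀ᵐ ω ∂P.prior, ∀ v : Node J, 0 < Latent.var v ω := by
  have hset : MeasurableSet {ω : Latent J K | ∀ v : Node J, 0 < Latent.var v ω} := by
    rw [Set.ofPred_forall]
    exact .iInter fun v => measurableSet_lt measurable_const (measurable_var v)
  refine Measure.ae_compProd_of_ae_ae hset (.of_forall fun x => ?_)
  rw [paramPrior_apply]
  refine ae_all_iff.2 fun v => ?_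
  have h : ∀ᵐ q ∂P.nodePrior v (x v), 0 < q.1 :=
    Measure.ae_compProd_of_ae_fst _ measurableSet_Ioi (ae_invGammaMeasure_pos _ _)
  exact (measurePreserving_eval (fun v => P.nodePrior v (x v)) v).quasiMeasurePreserving.ae h

lemma sampling_apply (ω : Latent J K) :
    sampling J n ω = Measure.pi fun v => Measure.pi fun h : Obs n =>
      gaussianReal (groupMean (ω.coef v) h.1) (ω.var v).toNNReal := rfl

lemma sampling_eq_withDensity {ω : Latent J K} (hω : ∀ v : Node J, 0 < Latent.var v ω) :
    sampling J n ω = volume.withDensity fun D => ENNReal.ofReal (lik D ω) := by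
  have hv : ∀ v, (ω.var v).toNNReal ≠ 0 := fun v => (Real.toNNReal_pos.2 (hω v)).ne'
  have hnode : ∀ v, (Measure.pi fun h : Obs n =>
      gaussianReal (groupMean (ω.coef v) h.1) (ω.var v).toNNReal) =
      volume.withDensity fun d => ENNReal.ofReal (nodeLik d (ω.param v)) := by
    intro v
    have hfin : ∀ h : Obs n, SigmaFinite ((volume : Measure ℝ).withDensity
        (gaussianPDF (groupMean (ω.coef v) h.1) (ω.var v).toNNReal)) := fun h => by
      rw [← gaussianReal_of_var_ne_zero _ (hv v)]; infer_instance
    simp_rw [fun m => gaussianReal_of_var_ne_zero m (hv v)]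
    rw [pi_withDensity (fun _ : Obs n => (volume : Measure ℝ))
      (fun _ => measurable_gaussianPDF _ _), ← volume_pi]
    congr 1
    ext d
    exact (ENNReal.ofReal_prod_of_nonneg fun _ _ => gaussianPDFReal_nonneg _ _ _).symm
  have hfin : ∀ v, SigmaFinite ((volume : Measure (Obs n → ℝ)).withDensity
      fun d => ENNReal.ofReal (nodeLik d (ω.param v))) := fun v => by
    rw [← hnode]; infer_instance
  rw [sampling_apply]
  simp_rw [hnode]
  rw [pi_withDensity (fun _ : Node J => (volume : Measure (Obs n → ℝ)))
    (f := fun v d => ENNReal.ofReal (nodeLik d (ω.param v)))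
    (fun v => (measurable_nodeLik_uncurry.comp measurable_prodMk_right).ennreal_ofReal),
    ← volume_pi]
  congr 1
  ext D
  exact (ENNReal.ofReal_prod_of_nonneg fun _ _ => nodeLik_nonneg _ _).symm

/-- The posterior law as a kernel in the data. -/
noncomputable def posteriorKernel : Kernel (Data J n) (Latent J K) where
  toFun := P.posteriorLaw
  measurable' := by
    refine Measure.measurable_of_measurable_coe _ fun s hs => ?_
    have hm : Measurable fun p : Data J n × Latent J K => ENNReal.ofReal (lik p.1 p.2) :=
      measurable_lik_uncurry.ennreal_ofReal
    simp only [posteriorLaw, Measure.smul_apply, withDensity_apply _ hs, smul_eq_mul]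
    exact (hm.lintegral_prod_right').inv.mul hm.lintegral_prod_right'

lemma posteriorKernel_apply (D : Data J n) : P.posteriorKernel D = P.posteriorLaw D := rfl

instance : IsMarkovKernel P.posteriorKernel :=
  ⟨P.isProbabilityMeasure_posteriorLaw⟩

/-- Reweighting the constant kernel of Lebesgue measure gives mass `1` in almost every fibre, as the
likelihood is a probability density in the data. -/
lemma prior_compProd_sampling : P.prior ⊗ₘ sampling J n =
    (P.prior.prod (volume : Measure (Data J n))).withDensity
      fun p => ENNReal.ofReal (lik p.2 p.1) := by
  have hm : Measurable fun p : Latent J K × Data J n => ENNReal.ofReal (lik p.2 p.1) :=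
    (measurable_lik_uncurry.comp measurable_swap).ennreal_ofReal
  rw [← Measure.compProd_const, compProd_withDensity_eq (c := 1) (η := sampling J n) hm
    measurable_one, withDensity_one]
  filter_upwards [P.ae_prior_var_pos] with ω hω
  rw [Kernel.const_apply, Pi.one_apply, one_smul, sampling_eq_withDensity hω]

/-- The joint law of the data and the latent quantities, disintegrated along the data. -/
lemma map_swap_prior_compProd_sampling :
    (P.prior ⊗ₘ sampling J n).map Prod.swap =
      ((volume : Measure (Data J n)).withDensity fun D => ENNReal.ofReal (P.ξ D Node.root (0, 0)))
        ⊗ₘ P.posteriorKernel := by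
  have hm : Measurable fun p : Data J n × Latent J K => ENNReal.ofReal (lik p.1 p.2) :=
    measurable_lik_uncurry.ennreal_ofReal
  have hξ : Measurable fun D : Data J n => ENNReal.ofReal (P.ξ D Node.root (0, 0)) := by
    simp_rw [← lintegral_lik]
    exact hm.lintegral_prod_right'
  -- The same joint density, now fibred over the data: the fibre over `D` is the reweighted prior,
  -- of mass `ξ` of the root.
  rw [← compProd_withDensity_eq (κ := Kernel.const _ P.prior) hm hξ
    (.of_forall fun D => ?_), Measure.compProd_const, prior_compProd_sampling,
    ← Measure.prod_swap (μ := P.prior), withDensity_map _ measurable_swap hm]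
  · rfl
  · rw [Kernel.const_apply, posteriorKernel_apply, posteriorLaw_eq, prior_withDensity]

/-- The swapped joint law identifies both the marginal of the data and a conditional kernel;
disintegrations are almost everywhere unique. -/
lemma posterior_ae_eq_posteriorLaw :
    ∀ᵐ D ∂(sampling J n ∘ₘ P.prior),
      posterior (sampling J n) P.prior D = P.posteriorLaw D := by
  have hmarg : sampling J n ∘ₘ P.prior =
      (volume : Measure (Data J n)).withDensity fun D =>
        ENNReal.ofReal (P.ξ D Node.root (0, 0)) := by
    rw [← Measure.snd_compProd, ← Measure.fst_map_swap, map_swap_prior_compProd_sampling,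
      Measure.fst_compProd]
  have h : (sampling J n ∘ₘ P.prior) ⊗ₘ P.posteriorKernel =
      (P.prior ⊗ₘ sampling J n).map Prod.swap := by
    rw [hmarg, map_swap_prior_compProd_sampling]
  filter_upwards [ae_eq_posterior_of_compProd_eq h] with D hD
  rw [← hD, posteriorKernel_apply]

end NIGMG

-- The theorem

theorem theorem2 (J K : ℕ) (n : Fin (K + 1) → ℕ) (P : NIGMG J K n) :
    -- Bayes' formula gives a version of the conditional law of the latent quantities given the data
    (∀ᵐ D ∂(NIGMG.sampling J n ∘ₘ P.prior),
      posterior (NIGMG.sampling J n) P.prior D = P.posteriorLaw D) ∧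
    ∀ D : Data J n,
      IsProbabilityMeasure (P.posteriorLaw D) ∧
      -- the node marginal likelihoods have the stated closed form
      (∀ v a, ∫⁻ q, ENNReal.ofReal (NIGMG.nodeLik (D v) q) ∂(P.nodePrior v a) =
        ENNReal.ofReal (P.m D v a)) ∧
      (∀ v a, 0 ≤ P.φ D v a ∧ 0 < P.ξ D v a) ∧
      -- the hidden states form a Markov tree under the posterior
      IsStochasticTree (P.postInit D) (P.postTrans D) ∧
      (P.posteriorLaw D).map Prod.fst = markovTree (P.postInit D) (P.postTrans D) ∧
      -- transition probabilities
      (∀ v : Node J, v ≠ Node.root → ∀ a b : HState,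
        P.posteriorLaw D (Latent.state v.parent ⁻¹' {a}) ≠ 0 →
        (P.posteriorLaw D)[Latent.state v ⁻¹' {b} | Latent.state v.parent ⁻¹' {a}] =
          ENNReal.ofReal
            (P.ρ v a.1 b.1 * P.κ v a.2 b.2 * P.φ D v b / P.ξ D v a)) ∧
      -- initial probabilities
      (∀ a : HState, P.posteriorLaw D (Latent.state Node.root ⁻¹' {a}) =
        ENNReal.ofReal
          (P.ρinit a.1 * P.κinit a.2 * P.φ D Node.root a / P.ξ D Node.root (0, 0))) ∧
      -- the variance of a node given its hidden states
      (∀ v : Node J, ∀ᵐ a ∂((P.posteriorLaw D).map (Latent.state v)),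
        condDistrib (Latent.var v) (Latent.state v) (P.posteriorLaw D) a =
          invGammaMeasure (P.ν + 1 + P.total / 2) (P.ν * P.σ₀sq + P.Υ D v a)) ∧
      -- the coefficients of a node given its variance and its hidden states
      (∀ v : Node J,
        ∀ᵐ q ∂((P.posteriorLaw D).map (fun ω => (Latent.var v ω, Latent.state v ω))),
          condDistrib (Latent.coef v) (fun ω => (Latent.var v ω, Latent.state v ω))
              (P.posteriorLaw D) q =
            normalVec (P.μstar D v q.2)
              (q.1 • (NIGMG.maskMatrix K q.2 ⊙ (P.Λstar v.1 q.2)⁻¹))) ∧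
      -- given all hidden states, the parameters of the nodes are independent, and those of a node
      -- depend on the states of that node only
      (∀ x : Node J → HState, P.posteriorLaw D (Prod.fst ⁻¹' {x}) ≠ 0 →
        ((P.posteriorLaw D)[|Prod.fst ⁻¹' {x}]).map Prod.snd =
          Measure.pi fun v =>
            ((P.posteriorLaw D)[|Latent.state v ⁻¹' {x v}]).map (Latent.param v)) := by
  exact ⟨P.posterior_ae_eq_posteriorLaw, fun D =>
    ⟨P.isProbabilityMeasure_posteriorLaw D, P.lintegral_nodeLik D,
      fun v a => ⟨(P.φ_pos D v a).le, P.ξ_pos D v a⟩, P.isStochasticTree_post D,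
      P.posteriorLaw_map_fst D, fun _ hv a b h0 => P.posteriorLaw_trans D hv a b h0,
      P.posteriorLaw_root D, P.condDistrib_var D, P.condDistrib_coef D,
      P.posteriorLaw_cond_states D⟩⟩
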